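/- **Setting.** Let $n,p\ge 1$, let $\mathbf X$ be a fixed real $n\times p$ matrix (the design), let $\sigma>0$ be known, and observe $\mathbf Y=\mathbf X\theta_0+\varepsilon$ with $\varepsilon\sim\mathcal N(0,\sigma^2I_n)$; write $\mathbb P_{\theta_0,\sigma}$ for the law of $\mathbf Y$. Let $\Theta[k,p]$ be the set of vectors of $\mathbb R^p$ with at most $k$ non-zero entries. A test is a measurable real function $\Phi$ of $\mathbf Y$ (which may depend on $\mathbf X$ and $\sigma$) that rejects $\theta_0=0$ when $\Phi>0$; it has level $\alpha$ if $\mathbb P_{0,\sigma}[\Phi>0]\le\alpha$. Put $$\rho_F[\Phi,k,\mathbf X]=\inf\Big\{\rho>0:\ \mathbb P_{\theta_0,\sigma}[\Phi>0]\ge 1-\delta\ \text{ for all }\theta_0\in\Theta[k,p]\text{ with }\|\mathbf X\theta_0\|\ge\sqrt n\,\rho\,\sigma\Big\}\in[0,\infty],$$ and let $\rho_F^*[k,\mathbf X]=\inf_\Phi\rho_F[\Phi,k,\mathbf X]$, the infimum being over all tests $\Phi$ of level $\alpha$ (the $(\alpha,\delta)$-minimax separation distance). **The test $T^*_\alpha$.**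 Let $\bar\chi_k(u)$ be the probability that a $\chi^2$ variable with $k$ degrees of freedom exceeds $u$, let $\Pi_m$ be the orthogonal projection of $\mathbb R^n$ onto the span of the columns of $\mathbf X$ with index in $m\subset\{1,\dots,p\}$, and let $k^*$ be the smallest integer $k\geq 1$ with $k[1+\log(p/k)]\ge\sqrt n$. Put $T^*_{\alpha,k}=\max_{|m|=k}\|\Pi_m\mathbf Y\|^2-\sigma^2\bar\chi_k^{-1}\big(\alpha/\binom pk\big)$ for $1\le k<k^*$, and $T^*_{\alpha,n}=\|\mathbf Y\|^2-\sigma^2\bar\chi_n^{-1}(\alpha)$. Then $$T^*_\alpha=\Big[\max_{1\le k<k^*}T^*_{\alpha/(2k^*),k}\Big]\vee T^*_{\alpha/2,n}.$$ **Theorem.** There is a universal constant $C>0$, and for all $\alpha,\delta>0$ with $\alpha+\delta\le 33\%$ there are constants $C_1(\alpha,\delta)$ and $C_2(\alpha,\delta)>0$, such that the following holds for all $\sigma>0$ and all $n,p$ with $p\ge n^2\ge C_1(\alpha,\delta)$ and $n\ge 8\log(2/\delta)$. 1. For every $1\le k\le n$ there is an $n\times p$ design $\mathbf X$ (not depending on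 $\sigma$) with $$(\rho_F^*[k,\mathbf X])^2\ \ge\ C\Big[\frac kn\log p\,\wedge\,\frac1{\sqrt n}\Big].$$ 2. For every $1\le k\le p$ and every $n\times p$ design $\mathbf X$, $$(\rho_F^*[k,\mathbf X])^2\ \le\ C_2(\alpha,\delta)\Big[\frac kn\log p\,\wedge\,\frac1{\sqrt n}\Big].$$ 3. This upper bound is achieved simultaneously for all $k$ and $\mathbf X$ by $T^*_\alpha$: for every design $\mathbf X$ the test $T^*_\alpha$ has level $\alpha$, and $(\rho_F[T^*_\alpha,k,\mathbf X])^2\le C_2(\alpha,\delta)\big[\frac kn\log p\wedge\frac1{\sqrt n}\big]$ for every $1\le k\le p$. Moreover, typical realizations of the standard Gaussian design satisfy the lower bound: for every $\eta\in(0,1)$ there is a constant $C_\eta>0$ depending only on $\eta$ such that, for all $\alpha,\delta>0$ with $\alpha+\delta\le33\%$, there is a constant $C_3(\alpha,\delta,\eta)$ for which the following holds: if $p\ge n^2\ge C_3(\alpha,\delta,\eta)$, $n\ge 8\log(2/\delta)$ and $1\le k\le n$, and if the entries of $\mathbf X$ are independent standard normal variables, then with probability at least $1-\eta$ one has $(\rho_F^*[k,\mathbf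 X])^2\ge C_\eta\big[\frac kn\log p\wedge\frac1{\sqrt n}\big]$ for all $\sigma>0$. -/

import Mathlib

open MeasureTheory ProbabilityTheory
open scoped ENNReal

noncomputable section

/-- The set `Θ[k,p]` of `k`-sparse vectors of `ℝ^p`. -/
def sparseVectors (k p : ℕ) : Set (Fin p → ℝ) :=
  {θ | (Finset.univ.filter fun i => θ i ≠ 0).card ≤ k}

/-- The mean vector `Xθ`, as an element of `ℝ^n` with its `l₂` norm. -/
def signal {n p : ℕ} (X : Matrix (Fin n) (Fin p) ℝ) (θ : Fin p → ℝ) :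
    EuclideanSpace ℝ (Fin n) :=
  WithLp.toLp 2 (X.mulVec θ)

/-- The law `P_{θ,σ}` of `Y = Xθ + ε` with `ε ∼ N(0, σ² I_n)`, for a fixed design `X`. -/
def responseLaw {n p : ℕ} (X : Matrix (Fin n) (Fin p) ℝ) (θ : Fin p → ℝ) (σ : ℝ) :
    Measure (EuclideanSpace ℝ (Fin n)) :=
  (stdGaussian (EuclideanSpace ℝ (Fin n))).map fun ε => signal X θ + σ • ε

/-- `Φ` is a test of level `α` of `θ₀ = 0` for the fixed design `X` and the known standard
deviation `σ`: a measurable statistic of `Y`, where the hypothesis is rejected when `Φ(Y) > 0`.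
(Zero-one valued tests are a special case.) -/
def IsLevelTest {n p : ℕ} (α : ℝ) (X : Matrix (Fin n) (Fin p) ℝ) (σ : ℝ)
    (Φ : EuclideanSpace ℝ (Fin n) → ℝ) : Prop :=
  Measurable Φ ∧ responseLaw X 0 σ {y | 0 < Φ y} ≤ ENNReal.ofReal α

/-- The `δ`-separation distance `ρ_F[Φ,k,X]` of the test `Φ` over `Θ[k,p]` (it is `∞` when no
`ρ > 0` qualifies). -/
def separationDistance {n p : ℕ} (δ : ℝ) (Φ : EuclideanSpace ℝ (Fin n) → ℝ) (k : ℕ)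
    (X : Matrix (Fin n) (Fin p) ℝ) (σ : ℝ) : ℝ≥0∞ :=
  sInf {r | ∃ ρ : ℝ, 0 < ρ ∧ r = ENNReal.ofReal ρ ∧
    ∀ θ ∈ sparseVectors k p, Real.sqrt n * ρ * σ ≤ ‖signal X θ‖ →
      ENNReal.ofReal (1 - δ) ≤ responseLaw X θ σ {y | 0 < Φ y}}

/-- The `(α,δ)`-minimax separation distance `ρ*_F[k,X]`: the infimum of the separation
distances of all tests of level `α`. -/
def minimaxSeparation {n p : ℕ} (α δ : ℝ) (k : ℕ) (X : Matrix (Fin n) (Fin p) ℝ) (σ : ℝ) :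
    ℝ≥0∞ :=
  ⨅ (Φ : EuclideanSpace ℝ (Fin n) → ℝ) (_ : IsLevelTest α X σ Φ), separationDistance δ Φ k X σ

/-- The rate `(k/n) log p ∧ 1/√n`. -/
def testingRate (k n p : ℕ) : ℝ :=
  min ((k : ℝ) / n * Real.log p) (1 / Real.sqrt n)

/-- The probability that a `χ²` variable with `k` degrees of freedom (the squared norm of a
standard Gaussian vector of `ℝ^k`) is larger than `u`. -/
def chiSqTail (k : ℕ) (u : ℝ) : ℝ :=
  (stdGaussian (EuclideanSpace ℝ (Fin k))).real {x | u < ‖x‖ ^ 2}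

/-- The inverse of `chiSqTail k`, that is, the upper quantile function of the `χ²` distribution
with `k` degrees of freedom; used for `k ≥ 1` and `0 < q < 1`. -/
def chiSqTailInv (k : ℕ) (q : ℝ) : ℝ :=
  sInf {u : ℝ | 0 ≤ u ∧ chiSqTail k u ≤ q}

/-- The span of the columns `X_i`, `i ∈ m`, of the design. -/
def columnSpan {n p : ℕ} (X : Matrix (Fin n) (Fin p) ℝ) (m : Finset (Fin p)) :
    Submodule ℝ (EuclideanSpace ℝ (Fin n)) :=
  Submodule.span ℝ ((fun i : Fin p => (WithLp.toLp 2 (X.col i) : EuclideanSpace ℝ (Fin n))) ''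
    (m : Set (Fin p)))

/-- The smallest positive integer `k` with `k (1 + log (p/k)) ≥ √n`. -/
def kStar (n p : ℕ) : ℕ :=
  sInf {k : ℕ | 1 ≤ k ∧ Real.sqrt n ≤ (k : ℝ) * (1 + Real.log ((p : ℝ) / k))}

/-- The statistic `T*_{α,k} = sup_{|m| = k} ‖Π_m Y‖² - σ² χ̄_k⁻¹(α / binom(p,k))`, for
`1 ≤ k < k*`. -/
def tStarSparse {n p : ℕ} (α : ℝ) (k : ℕ) (X : Matrix (Fin n) (Fin p) ℝ) (σ : ℝ)
    (y : EuclideanSpace ℝ (Fin n)) : ℝ :=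
  (⨆ m : {m : Finset (Fin p) // m.card = k}, ‖(columnSpan X m.1).starProjection y‖ ^ 2)
    - σ ^ 2 * chiSqTailInv k (α / (p.choose k : ℝ))

/-- The statistic `T*_{α,n} = ‖Y‖² - σ² χ̄_n⁻¹(α)`. -/
def tStarFull {n : ℕ} (α : ℝ) (σ : ℝ) (y : EuclideanSpace ℝ (Fin n)) : ℝ :=
  ‖y‖ ^ 2 - σ ^ 2 * chiSqTailInv n α

/-- The procedure `T*_α`: the maximum of `T*_{α/2,n}` and of the `T*_{α/(2k*),k}`,
`1 ≤ k < k*`. -/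
def tStar {n p : ℕ} (α : ℝ) (X : Matrix (Fin n) (Fin p) ℝ) (σ : ℝ)
    (y : EuclideanSpace ℝ (Fin n)) : ℝ :=
  (Finset.Ico 1 (kStar n p)).fold max (tStarFull (α / 2) σ y)
    fun k => tStarSparse (α / (2 * (kStar n p : ℝ))) k X σ y

/-- The law of the entries of a standard Gaussian `n × p` design: they are independent and
standard normal. -/
def gaussianDesign (n p : ℕ) : Measure (Fin n → Fin p → ℝ) :=
  Measure.pi fun _ => Measure.pi fun _ => gaussianReal 0 1

end

/-! ### Projections of Gaussian vectors and chi-square comparison -/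

section StdGaussian

variable {E : Type*} [NormedAddCommGroup E] [InnerProductSpace ℝ E] [FiniteDimensional ℝ E]
  [MeasurableSpace E] [BorelSpace E]

/-! Upper bound. The noise part of `‖Π_m Y‖²` is at most a chi-square variable with `|m|` degrees of
freedom, so the quantile thresholds and union bounds over subsets and over `k < k*` give the level
(`isLevelTest_tStar`). For power there are two regimes. If `√n ≤ 2k log p`, the rate is of order
`1/√n` and `‖Y‖²` detects the signal: by Chebyshev both its fluctuation and its quantile stay within
order `√n` of `n` (`tStar_power_of_dense`). Otherwise `k < k*`, and projecting on a set of `k`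
columns containing the support keeps the whole signal. The chi-square tail `exp (k - u/4)` makes the
threshold at level `α/(2k* binom(p,k))` of order `k log p`, with a factor depending on `α`
(`tStar_power_of_sparse`).

Lower bound. A test powerful at every member of a finite family is powerful against its uniform
mixture. By Cameron-Martin the likelihood ratio of the mixture has second moment equal to the
average of `exp ⟨h_J, h_J'⟩`, and testing with `α + δ ≤ 0.33` forces this average above `2`
(`two_mul_card_sq_lt_sum_exp_inner`). The family consists of unit vectors with one equal non-zero
entry in each of `k` blocks of length `⌊p/k⌋`, scaled by `√Λ`. For a Gaussian design the rows are
independent, and the expectation of `exp (Λ⟨Xu, Xv⟩)` is at most `exp (n(Λ⟨u,v⟩ + 200Λ²))`. With `Λ`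
a small multiple of the rate, `nΛ²` is small, and the overlaps `⟨u,v⟩` contribute little because two
random block vectors rarely agree (`sum_exp_blockVector_le`).

Markov's inequality then gives, for most designs, a second moment below `3/2`, and `‖Xu‖² > n/2` for
nine tenths of the family; discarding the other vectors keeps the average below `2`. This proves the
statement on typical designs, and taking `η = 1/2` there shows that a suitable design exists. -/

theorem stdGaussian_map_inner (h : E) :
    (stdGaussian E).map (fun x => inner ℝ h x) = gaussianReal 0 (‖h‖₊ ^ 2) := by
  have key := IsGaussian.map_eq_gaussianReal (μ := stdGaussian E) (innerSL ℝ h)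
  rw [variance_dual_stdGaussian, integral_strongDual_stdGaussian, innerSL_apply_norm,
    show (‖h‖ ^ 2).toNNReal = ‖h‖₊ ^ 2 by rw [Real.toNNReal_pow (norm_nonneg h), norm_toNNReal]]
    at key
  exact key

/-- The orthogonal projection of a standard Gaussian vector is standard Gaussian. -/
theorem stdGaussian_map_orthogonalProjectionOnto (V : Submodule ℝ E) :
    (stdGaussian E).map V.orthogonalProjectionOnto = stdGaussian V := by
  have : IsProbabilityMeasure ((stdGaussian E).map V.orthogonalProjectionOnto) :=
    Measure.isProbabilityMeasure_map (by fun_prop)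
  apply Measure.ext_of_charFun
  ext t
  have h1 : charFun ((stdGaussian E).map V.orthogonalProjectionOnto) t
      = charFun (stdGaussian E) (t : E) := by
    rw [charFun_apply, charFun_apply, integral_map (by fun_prop)
      (Measurable.aestronglyMeasurable (by fun_prop))]
    simp_rw [Submodule.coe_inner, Submodule.coe_orthogonalProjectionOnto_apply,
      Submodule.inner_starProjection_left_eq_right,
      Submodule.starProjection_eq_self_iff.2 t.2]
  rw [h1, charFun_stdGaussian, charFun_stdGaussian]
  simp

theorem stdGaussian_starProjection_tail (V : Submodule ℝ E) (u : ℝ) :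
    (stdGaussian E).real {x | u < ‖V.starProjection x‖ ^ 2}
      = chiSqTail (Module.finrank ℝ V) u := by
  have e := (stdOrthonormalBasis ℝ V).repr
  have hset : MeasurableSet {x : EuclideanSpace ℝ (Fin (Module.finrank ℝ V)) | u < ‖x‖ ^ 2} :=
    measurableSet_lt measurable_const (by fun_prop)
  have hmeas : Measurable e := e.continuous.measurable
  rw [chiSqTail, ← stdGaussian_map e, ← stdGaussian_map_orthogonalProjectionOnto V,
    map_measureReal_apply hmeas hset, map_measureReal_apply (by fun_prop) (hmeas hset)]
  simp

/-- Projecting `ℝ^k` on `r` coordinate axes shrinks the norm. This is needed because `k` columns may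
be linearly dependent, while the threshold always uses `k` degrees of freedom. -/
theorem chiSqTail_mono_left {r k : ℕ} (hrk : r ≤ k) (u : ℝ) : chiSqTail r u ≤ chiSqTail k u := by
  let b := (EuclideanSpace.basisFun (Fin k) ℝ)
  have hli : LinearIndependent ℝ (fun i : Fin r => b (Fin.castLE hrk i)) :=
    b.orthonormal.linearIndependent.comp _ (Fin.castLE_injective hrk)
  have hW := finrank_span_eq_card hli
  rw [Fintype.card_fin] at hW
  have h := stdGaussian_starProjection_tail
    (Submodule.span ℝ (Set.range fun i : Fin r => b (Fin.castLE hrk i))) u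
  rw [hW] at h
  rw [← h]
  refine measureReal_mono fun x hx => lt_of_lt_of_le (Set.mem_ofPred_eq ▸ hx) ?_
  gcongr
  exact Submodule.norm_starProjection_apply_le _ x

theorem stdGaussian_starProjection_tail_le (V : Submodule ℝ E) {k : ℕ}
    (hk : Module.finrank ℝ V ≤ k) (u : ℝ) :
    (stdGaussian E).real {x | u < ‖V.starProjection x‖ ^ 2} ≤ chiSqTail k u :=
  (stdGaussian_starProjection_tail V u).trans_le (chiSqTail_mono_left hk u)

end StdGaussian

/-! ### Chi-square tails, quantiles and variance -/

theorem stdGaussian_measurePreserving_toLp (n : ℕ) :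
    MeasurePreserving (WithLp.toLp 2) (Measure.pi fun _ : Fin n => gaussianReal 0 1)
      (stdGaussian (EuclideanSpace ℝ (Fin n))) :=
  ⟨by fun_prop, map_pi_eq_stdGaussian⟩

theorem integral_stdGaussian_eq_pi {F : Type*} [NormedAddCommGroup F] [NormedSpace ℝ F] (n : ℕ)
    (f : EuclideanSpace ℝ (Fin n) → F) :
    ∫ x, f x ∂stdGaussian (EuclideanSpace ℝ (Fin n))
      = ∫ x, f (WithLp.toLp 2 x) ∂Measure.pi fun _ : Fin n => gaussianReal 0 1 :=
  ((stdGaussian_measurePreserving_toLp n).integral_comp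
    (MeasurableEquiv.toLp 2 (Fin n → ℝ)).measurableEmbedding f).symm

theorem gaussianPDFReal_zero_one_mul_exp (x : ℝ) :
    gaussianPDFReal 0 1 x * Real.exp (x ^ 2 / 4)
      = (√(2 * Real.pi))⁻¹ * Real.exp (-(1 / 4) * x ^ 2) := by
  rw [gaussianPDFReal, mul_assoc, ← Real.exp_add]
  congr 2
  · simp
  · simp; ring

theorem integral_exp_sq_div_four : ∫ x, Real.exp (x ^ 2 / 4) ∂gaussianReal 0 1 = √2 := by
  rw [integral_gaussianReal_eq_integral_smul one_ne_zero]
  simp_rw [smul_eq_mul, gaussianPDFReal_zero_one_mul_exp]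
  rw [integral_const_mul, integral_gaussian, ← Real.sqrt_inv, ← Real.sqrt_mul (by positivity)]
  congr 1
  field_simp
  norm_num

theorem integrable_exp_sq_div_four : Integrable (fun x => Real.exp (x ^ 2 / 4)) (gaussianReal 0 1) :=
  .of_integral_ne_zero (by rw [integral_exp_sq_div_four]; positivity)

theorem integrable_exp_norm_sq_div_four (n : ℕ) :
    Integrable (fun x => Real.exp (‖x‖ ^ 2 / 4)) (stdGaussian (EuclideanSpace ℝ (Fin n))) := by
  have h := Integrable.fintype_prod (ι := Fin n) (fun _ => integrable_exp_sq_div_four)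
  rw [← (stdGaussian_measurePreserving_toLp n).integrable_comp_emb
    (MeasurableEquiv.toLp 2 (Fin n → ℝ)).measurableEmbedding]
  refine h.congr (.of_forall fun x => ?_)
  simp [EuclideanSpace.norm_sq_eq, Finset.sum_div, Real.exp_sum]

theorem integral_exp_norm_sq_div_four (n : ℕ) :
    ∫ x, Real.exp (‖x‖ ^ 2 / 4) ∂stdGaussian (EuclideanSpace ℝ (Fin n)) = √2 ^ n := by
  rw [integral_stdGaussian_eq_pi]
  simp_rw [EuclideanSpace.norm_sq_eq, Finset.sum_div, Real.exp_sum, Real.norm_eq_abs, sq_abs]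
  rw [integral_fintype_prod_eq_prod (f := fun _ x => Real.exp (x ^ 2 / 4))]
  simp [integral_exp_sq_div_four]

/-- Exponential Markov with parameter `1/4`, where the moment is `√2 ^ k ≤ e ^ k`. The exponential
decay is what lets a union bound over `binom(p,k)` subsets cost only order `k log p`. -/
theorem chiSqTail_le_exp (k : ℕ) (u : ℝ) : chiSqTail k u ≤ Real.exp (k - u / 4) := by
  have h := mul_meas_ge_le_integral_of_nonneg (.of_forall fun x => (Real.exp_pos _).le)
    (integrable_exp_norm_sq_div_four k) (Real.exp (u / 4))
  rw [integral_exp_norm_sq_div_four] at h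
  have h1 : chiSqTail k u ≤ (stdGaussian (EuclideanSpace ℝ (Fin k))).real
      {x | Real.exp (u / 4) ≤ Real.exp (‖x‖ ^ 2 / 4)} := by
    refine measureReal_mono fun x hx => ?_
    have : u < ‖x‖ ^ 2 := hx
    simp only [Set.mem_ofPred_eq, Real.exp_le_exp]
    linarith
  have h2 : √2 ^ k ≤ Real.exp k := by
    rw [← mul_one (k : ℝ), Real.exp_nat_mul]
    gcongr
    have := Real.add_one_le_exp (1 : ℝ)
    rw [Real.sqrt_le_left (Real.exp_pos _).le]
    nlinarith
  rw [Real.exp_sub, le_div_iff₀ (Real.exp_pos _), mul_comm]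
  calc _ ≤ _ := mul_le_mul_of_nonneg_left h1 (Real.exp_pos _).le
    _ ≤ _ := h
    _ ≤ _ := h2

theorem chiSqTail_antitone (k : ℕ) : Antitone (chiSqTail k) :=
  fun _ _ h => measureReal_mono fun _ hx => lt_of_le_of_lt h hx

theorem chiSqTailInv_le {k : ℕ} {q u : ℝ} (hu : 0 ≤ u) (h : chiSqTail k u ≤ q) :
    chiSqTailInv k q ≤ u :=
  csInf_le ⟨0, fun _ hx => hx.1⟩ ⟨hu, h⟩

/-- The tail is right continuous, because `{u₀ < ‖x‖²}` is the increasing union of the sets with `u₀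
+ 1/(m+1)`; hence the infimum itself satisfies the constraint. -/
theorem chiSqTail_chiSqTailInv_le {k : ℕ} {q : ℝ} (hq : 0 < q) :
    chiSqTail k (chiSqTailInv k q) ≤ q := by
  set u₀ := chiSqTailInv k q
  have hne : {u : ℝ | 0 ≤ u ∧ chiSqTail k u ≤ q}.Nonempty := by
    refine ⟨max 0 (4 * (k - Real.log q)), le_max_left _ _, (chiSqTail_le_exp _ _).trans ?_⟩
    rw [← Real.le_log_iff_exp_le hq]
    linarith [le_max_right 0 (4 * (k - Real.log q))]
  have hgt : ∀ u, u₀ < u → chiSqTail k u ≤ q := fun u hu => by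
    obtain ⟨v, hv, hvu⟩ := exists_lt_of_csInf_lt hne hu
    exact (chiSqTail_antitone k hvu.le).trans hv.2
  have hU : {x : EuclideanSpace ℝ (Fin k) | u₀ < ‖x‖ ^ 2}
      = ⋃ m : ℕ, {x | u₀ + 1 / ((m : ℝ) + 1) < ‖x‖ ^ 2} := by
    ext x
    simp only [Set.mem_ofPred_eq, Set.mem_iUnion]
    constructor
    · intro hx
      obtain ⟨m, hm⟩ := exists_nat_one_div_lt (sub_pos.2 hx)
      exact ⟨m, by linarith⟩
    · rintro ⟨m, hm⟩
      have : (0 : ℝ) < 1 / ((m : ℝ) + 1) := by positivity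
      linarith
  have hmono : Monotone fun m : ℕ =>
      {x : EuclideanSpace ℝ (Fin k) | u₀ + 1 / ((m : ℝ) + 1) < ‖x‖ ^ 2} := by
    intro a b hab x hx
    have : 1 / ((b : ℝ) + 1) ≤ 1 / ((a : ℝ) + 1) := by gcongr
    have hx' : u₀ + 1 / ((a : ℝ) + 1) < ‖x‖ ^ 2 := hx
    exact lt_of_le_of_lt (by linarith) hx'
  have ht := tendsto_measure_iUnion_atTop (μ := stdGaussian (EuclideanSpace ℝ (Fin k))) hmono
  rw [← hU] at ht
  have hle : stdGaussian (EuclideanSpace ℝ (Fin k)) {x | u₀ < ‖x‖ ^ 2} ≤ ENNReal.ofReal q := by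
    refine le_of_tendsto' ht fun m => ?_
    rw [Function.comp, ← ofReal_measureReal]
    exact ENNReal.ofReal_le_ofReal (hgt _ (by
      have : (0 : ℝ) < 1 / ((m : ℝ) + 1) := by positivity
      linarith))
  exact ENNReal.toReal_le_of_le_ofReal hq.le hle

/-- The variance of the square of a standard normal variable. -/
noncomputable def sqNormalVar : ℝ := Var[fun x => x ^ 2; gaussianReal 0 1]

theorem memLp_sq_gaussianReal : MemLp (fun x : ℝ => x ^ 2) 2 (gaussianReal 0 1) := by
  have h := (memLp_id_gaussianReal (μ := 0) (v := 1) 4)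
  have := h.norm_rpow_div (2 : ℝ≥0∞)
  have h2 : ((4 : NNReal) : ℝ≥0∞) / 2 = 2 := by
    rw [show ((4 : NNReal) : ℝ≥0∞) = 2 * 2 by norm_num,
      ENNReal.mul_div_cancel_right (by simp) (by simp)]
  rw [h2] at this
  simpa using this

theorem integral_sq_gaussianReal : ∫ x, x ^ 2 ∂gaussianReal 0 1 = 1 := by
  have h := variance_fun_id_gaussianReal (μ := 0) (v := 1)
  change Var[id; gaussianReal 0 1] = _ at h
  rw [variance_eq_sub (memLp_id_gaussianReal' 2 (by simp))] at h
  simpa using h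

theorem stdGaussian_norm_sq_chebyshev (n : ℕ) {s : ℝ} (hs : 0 < s) :
    (stdGaussian (EuclideanSpace ℝ (Fin n))).real {x | s ≤ |‖x‖ ^ 2 - n|}
      ≤ n * sqNormalVar / s ^ 2 := by
  have hmem : MemLp (∑ i, fun ω : Fin n → ℝ => (ω i) ^ 2) 2
      (Measure.pi fun _ : Fin n => gaussianReal 0 1) :=
    memLp_finsetSum' _ fun i _ => memLp_sq_gaussianReal.comp_measurePreserving
      (measurePreserving_eval (fun _ : Fin n => gaussianReal 0 1) i)
  have hvar := variance_sum_pi (μ := fun _ : Fin n => gaussianReal 0 1)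
    (X := fun _ x => x ^ 2) fun _ => memLp_sq_gaussianReal
  have hint : ∫ x, (∑ i, fun ω : Fin n → ℝ => (ω i) ^ 2) x
      ∂(Measure.pi fun _ : Fin n => gaussianReal 0 1) = n := by
    simp only [Finset.sum_apply]
    rw [integral_finsetSum]
    · simp_rw [integral_comp_eval (μ := fun _ : Fin n => gaussianReal 0 1)
        (f := fun x : ℝ => x ^ 2) (by fun_prop), integral_sq_gaussianReal]
      simp
    · exact fun i _ => integrable_comp_eval (μ := fun _ : Fin n => gaussianReal 0 1)
        (memLp_sq_gaussianReal.integrable one_le_two)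
  have hch := meas_ge_le_variance_div_sq hmem hs
  rw [hint, hvar] at hch
  have hset : MeasurableSet {x : EuclideanSpace ℝ (Fin n) | s ≤ |‖x‖ ^ 2 - n|} :=
    measurableSet_le measurable_const (by fun_prop)
  rw [measureReal_def, ← map_pi_eq_stdGaussian, Measure.map_apply (by fun_prop) hset]
  have hv : 0 ≤ sqNormalVar := variance_nonneg _ _
  refine ENNReal.toReal_le_of_le_ofReal (by positivity) ?_
  convert hch using 2
  · ext x; simp [EuclideanSpace.norm_sq_eq]
  · simp [sqNormalVar]

/-! ### The regression model and the test `T*` -/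

section Model

variable {n p : ℕ}

theorem responseLaw_apply (X : Matrix (Fin n) (Fin p) ℝ) (θ : Fin p → ℝ) (σ : ℝ)
    {s : Set (EuclideanSpace ℝ (Fin n))} (hs : MeasurableSet s) :
    responseLaw X θ σ s
      = stdGaussian (EuclideanSpace ℝ (Fin n)) {ε | signal X θ + σ • ε ∈ s} :=
  Measure.map_apply (by fun_prop) hs

theorem signal_zero (X : Matrix (Fin n) (Fin p) ℝ) : signal X 0 = 0 := by
  simp [signal]

theorem signal_mem_columnSpan (X : Matrix (Fin n) (Fin p) ℝ) {θ : Fin p → ℝ}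
    {m : Finset (Fin p)} (hm : ∀ i, θ i ≠ 0 → i ∈ m) : signal X θ ∈ columnSpan X m := by
  have h : signal X θ = ∑ i, θ i • (WithLp.toLp 2 (X.col i) : EuclideanSpace ℝ (Fin n)) := by
    ext j
    simp [signal, Matrix.mulVec, dotProduct, Matrix.col, mul_comm]
  rw [h]
  refine Submodule.sum_mem _ fun i _ => ?_
  by_cases hi : θ i = 0
  · simp [hi]
  · exact Submodule.smul_mem _ _ (Submodule.subset_span ⟨i, hm i hi, rfl⟩)

theorem finrank_columnSpan_le (X : Matrix (Fin n) (Fin p) ℝ) (m : Finset (Fin p)) :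
    Module.finrank ℝ (columnSpan X m) ≤ m.card := by
  classical
  rw [columnSpan, ← Finset.coe_image]
  exact (finrank_span_finset_le_card _).trans Finset.card_image_le

theorem measurable_tStarFull (α σ : ℝ) : Measurable (tStarFull (n := n) α σ) := by
  unfold tStarFull; fun_prop

theorem measurable_tStarSparse (α : ℝ) (k : ℕ) (X : Matrix (Fin n) (Fin p) ℝ) (σ : ℝ) :
    Measurable (tStarSparse α k X σ) := by
  unfold tStarSparse
  refine Measurable.sub_const (Measurable.iSup fun m => ?_) _
  fun_prop

theorem measurable_tStar (α : ℝ) (X : Matrix (Fin n) (Fin p) ℝ) (σ : ℝ) :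
    Measurable (tStar α X σ) := by
  unfold tStar
  induction Finset.Ico 1 (kStar n p) using Finset.induction_on with
  | empty => simpa using measurable_tStarFull _ _
  | insert a s ha ih =>
    simp_rw [Finset.fold_insert ha]
    exact (measurable_tStarSparse _ _ _ _).max ih

theorem tStar_pos_iff {α σ : ℝ} {X : Matrix (Fin n) (Fin p) ℝ} {y : EuclideanSpace ℝ (Fin n)} :
    0 < tStar α X σ y ↔ 0 < tStarFull (α / 2) σ y ∨
      ∃ k ∈ Finset.Ico 1 (kStar n p), 0 < tStarSparse (α / (2 * (kStar n p : ℝ))) k X σ y :=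
  Finset.lt_fold_max 0

/-! ### The index `k*` -/

theorem kStar_mem (hp : √n ≤ (p : ℝ)) (hp1 : 1 ≤ p) :
    kStar n p ∈ {k : ℕ | 1 ≤ k ∧ √n ≤ (k : ℝ) * (1 + Real.log ((p : ℝ) / k))} := by
  refine Nat.sInf_mem ⟨p, hp1, ?_⟩
  rw [div_self (by positivity)]
  simpa using hp

theorem kStar_le (hp : √n ≤ (p : ℝ)) (hp1 : 1 ≤ p) : kStar n p ≤ p := by
  refine Nat.sInf_le ⟨hp1, ?_⟩
  rw [div_self (by positivity)]
  simpa using hp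

/-- Every sparsity that `T*` does not scan lies in the dense regime, where `‖Y‖²` suffices. -/
theorem sqrt_le_of_kStar_le (hp : √n ≤ (p : ℝ)) (hp1 : 1 ≤ p) (hlog : 1 ≤ Real.log p) {k : ℕ}
    (hk : kStar n p ≤ k) : √n ≤ 2 * (k * Real.log p) := by
  obtain ⟨h1, h2⟩ := kStar_mem hp hp1
  have hk1 : (1 : ℝ) ≤ kStar n p := by exact_mod_cast h1
  have hp0 : (0 : ℝ) < p := by exact_mod_cast hp1
  have hl : Real.log ((p : ℝ) / kStar n p) ≤ Real.log p :=
    Real.log_le_log (by positivity) (div_le_self hp0.le hk1)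
  have hk' : (kStar n p : ℝ) ≤ k := by exact_mod_cast hk
  calc √n ≤ kStar n p * (1 + Real.log ((p : ℝ) / kStar n p)) := h2
    _ ≤ k * (2 * Real.log p) := mul_le_mul hk' (by linarith) (by nlinarith [Real.sqrt_nonneg n]) (by positivity)
    _ = _ := by ring

/-! ### The level of `T*` -/

theorem tStarFull_level {q σ : ℝ} (hq : 0 < q) (hσ : 0 < σ) :
    (stdGaussian (EuclideanSpace ℝ (Fin n))).real {ε | 0 < tStarFull q σ (σ • ε)} ≤ q := by
  refine (measureReal_mono fun ε hε => ?_).trans (chiSqTail_chiSqTailInv_le (k := n) hq)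
  have h : 0 < ‖σ • ε‖ ^ 2 - σ ^ 2 * chiSqTailInv n q := hε
  rw [norm_smul, Real.norm_eq_abs, mul_pow, sq_abs, ← mul_sub] at h
  have := pos_of_mul_pos_right h (by positivity)
  exact sub_pos.1 this

theorem tStarSparse_level {q σ : ℝ} (hq : 0 < q) (hσ : 0 < σ) (X : Matrix (Fin n) (Fin p) ℝ)
    {k : ℕ} (hkp : k ≤ p) :
    (stdGaussian (EuclideanSpace ℝ (Fin n))).real {ε | 0 < tStarSparse q k X σ (σ • ε)} ≤ q := by
  have hC : 0 < (p.choose k : ℝ) := by exact_mod_cast Nat.choose_pos hkp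
  have hcard : Fintype.card {m : Finset (Fin p) // m.card = k} = p.choose k := by
    simp
  have hne : Nonempty {m : Finset (Fin p) // m.card = k} := by
    rw [← Fintype.card_pos_iff, hcard]; exact Nat.choose_pos hkp
  set u := chiSqTailInv k (q / (p.choose k : ℝ)) with hu
  have hsub : {ε : EuclideanSpace ℝ (Fin n) | 0 < tStarSparse q k X σ (σ • ε)} ⊆
      ⋃ m : {m : Finset (Fin p) // m.card = k},
        {ε | u < ‖(columnSpan X m.1).starProjection ε‖ ^ 2} := by
    intro ε hε
    have h : 0 < (⨆ m : {m : Finset (Fin p) // m.card = k},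
      ‖(columnSpan X m.1).starProjection (σ • ε)‖ ^ 2) - σ ^ 2 * u := hε
    obtain ⟨m, hm⟩ := exists_lt_of_lt_ciSup (sub_pos.1 h)
    refine Set.mem_iUnion.2 ⟨m, ?_⟩
    rw [map_smul, norm_smul, Real.norm_eq_abs, mul_pow, sq_abs] at hm
    exact lt_of_mul_lt_mul_left hm (by positivity)
  refine (measureReal_mono hsub).trans ((measureReal_iUnion_fintype_le _).trans ?_)
  have : ∀ m : {m : Finset (Fin p) // m.card = k}, (stdGaussian (EuclideanSpace ℝ (Fin n))).real
      {ε | u < ‖(columnSpan X m.1).starProjection ε‖ ^ 2} ≤ q / (p.choose k : ℝ) := fun m =>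
    (stdGaussian_starProjection_tail_le _ ((finrank_columnSpan_le X m.1).trans m.2.le) u).trans
      (chiSqTail_chiSqTailInv_le (by positivity))
  refine (Finset.sum_le_sum fun m _ => this m).trans ?_
  rw [Finset.sum_const, Finset.card_univ, hcard, nsmul_eq_mul, mul_div_cancel₀ _ hC.ne']

/-- Half of `α` goes to the full statistic; the `k* - 1` sparse ones share the other half, `α/(2k*)`
each. -/
theorem isLevelTest_tStar {α σ : ℝ} (hα : 0 < α) (hσ : 0 < σ) (X : Matrix (Fin n) (Fin p) ℝ)
    (hp : √n ≤ (p : ℝ)) (hp1 : 1 ≤ p) : IsLevelTest α X σ (tStar α X σ) := by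
  refine ⟨measurable_tStar _ _ _, ?_⟩
  have hK : (0 : ℝ) < kStar n p := by exact_mod_cast (kStar_mem hp hp1).1
  rw [responseLaw_apply _ _ _ (measurableSet_lt measurable_const (measurable_tStar _ _ _)),
    signal_zero, ← ofReal_measureReal]
  refine ENNReal.ofReal_le_ofReal ?_
  have hsub : {ε : EuclideanSpace ℝ (Fin n) | 0 + σ • ε ∈ {y | 0 < tStar α X σ y}} ⊆
      {ε | 0 < tStarFull (α / 2) σ (σ • ε)} ∪ ⋃ k ∈ Finset.Ico 1 (kStar n p),
        {ε | 0 < tStarSparse (α / (2 * (kStar n p : ℝ))) k X σ (σ • ε)} := by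
    intro ε hε
    have h : 0 < tStar α X σ (0 + σ • ε) := hε
    rw [zero_add, tStar_pos_iff] at h
    simpa using h
  refine (measureReal_mono hsub).trans ((measureReal_union_le _ _).trans ?_)
  have h1 := tStarFull_level (n := n) (half_pos hα) hσ
  have h2 : ∀ k ∈ Finset.Ico 1 (kStar n p), (stdGaussian (EuclideanSpace ℝ (Fin n))).real
      {ε | 0 < tStarSparse (α / (2 * (kStar n p : ℝ))) k X σ (σ • ε)}
        ≤ α / (2 * (kStar n p : ℝ)) := fun k hk =>
    tStarSparse_level (by positivity) hσ X
      ((Finset.mem_Ico.1 hk).2.le.trans (kStar_le hp hp1))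
  have h3 := (measureReal_biUnion_finset_le (μ := stdGaussian (EuclideanSpace ℝ (Fin n)))
    (Finset.Ico 1 (kStar n p)) fun k =>
      {ε | 0 < tStarSparse (α / (2 * (kStar n p : ℝ))) k X σ (σ • ε)}).trans
        (Finset.sum_le_sum h2)
  rw [Finset.sum_const, Nat.card_Ico, nsmul_eq_mul] at h3
  have h4 : ((kStar n p - 1 : ℕ) : ℝ) * (α / (2 * (kStar n p : ℝ))) ≤ α / 2 := by
    calc _ ≤ (kStar n p : ℝ) * (α / (2 * (kStar n p : ℝ))) := by gcongr; omega
      _ = _ := by field_simp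
  linarith

/-! ### The power of `T*` -/

theorem one_sub_le_measureReal_of_compl_subset {Ω : Type*} [MeasurableSpace Ω] {μ : Measure Ω}
    [IsProbabilityMeasure μ] {A B : Set Ω} {δ : ℝ} (h : ∀ ω, ω ∉ B → ω ∈ A) (hB : μ.real B ≤ δ) :
    1 - δ ≤ μ.real A := by
  have h1 : μ.real (Set.univ : Set Ω) ≤ μ.real (A ∪ B) :=
    measureReal_mono fun ω _ => by
      by_cases hω : ω ∈ B
      · exact Or.inr hω
      · exact Or.inl (h ω hω)
  have h2 := measureReal_union_le (μ := μ) A B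
  rw [probReal_univ] at h1
  linarith

/-- Projection on a span containing the signal leaves it unchanged and reduces the noise to at most
`k` dimensions. Here `u` bounds the projected noise with probability `1 - δ`, and `v` bounds the
threshold. -/
theorem tStarSparse_power {q σ δ u v : ℝ} (hσ : 0 < σ)
    {X : Matrix (Fin n) (Fin p) ℝ} {k : ℕ} (hkp : k ≤ p) {θ : Fin p → ℝ}
    (hθ : θ ∈ sparseVectors k p) (hv0 : 0 ≤ v)
    (hu : Real.exp (k - u / 4) ≤ δ) (hv : Real.exp (k - v / 4) ≤ q / (p.choose k : ℝ))
    (hsep : σ * (√u + √v) < ‖signal X θ‖) :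
    1 - δ ≤ (stdGaussian (EuclideanSpace ℝ (Fin n))).real
      {ε | 0 < tStarSparse q k X σ (signal X θ + σ • ε)} := by
  -- The support may have fewer than `k` elements, but the maximum runs over sets of size exactly
  -- `k`.
  obtain ⟨m, hm1, hm2⟩ := Finset.exists_superset_card_eq
    (s := Finset.univ.filter fun i => θ i ≠ 0) (n := k) hθ (by simpa using hkp)
  have hfix : (columnSpan X m).starProjection (signal X θ) = signal X θ :=
    Submodule.starProjection_eq_self_iff.2 (signal_mem_columnSpan X fun i hi => hm1 (by simpa using hi))
  refine one_sub_le_measureReal_of_compl_subset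
    (B := {ε | u < ‖(columnSpan X m).starProjection ε‖ ^ 2}) (fun ε hε => ?_)
    ((stdGaussian_starProjection_tail_le _ ((finrank_columnSpan_le X m).trans hm2.le) u).trans
      ((chiSqTail_le_exp _ _).trans hu))
  have hε' : ‖(columnSpan X m).starProjection ε‖ ≤ √u := Real.le_sqrt_of_sq_le (not_lt.1 hε)
  have hinv : chiSqTailInv k (q / (p.choose k : ℝ)) ≤ v :=
    chiSqTailInv_le hv0 ((chiSqTail_le_exp _ _).trans hv)
  have hlow : σ * √v < ‖(columnSpan X m).starProjection (signal X θ + σ • ε)‖ := by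
    rw [map_add, map_smul, hfix]
    have h1 := norm_sub_le (signal X θ + σ • (columnSpan X m).starProjection ε)
      (σ • (columnSpan X m).starProjection ε)
    rw [add_sub_cancel_right, norm_smul, Real.norm_of_nonneg hσ.le] at h1
    have h2 := mul_le_mul_of_nonneg_left hε' hσ.le
    linarith
  have hsq : σ ^ 2 * v < ‖(columnSpan X m).starProjection (signal X θ + σ • ε)‖ ^ 2 := by
    have := pow_lt_pow_left₀ hlow (by positivity) two_ne_zero
    rwa [mul_pow, Real.sq_sqrt hv0] at this
  have hsup := le_ciSup (Set.finite_range fun m : {m : Finset (Fin p) // m.card = k} =>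
    ‖(columnSpan X m.1).starProjection (signal X θ + σ • ε)‖ ^ 2).bddAbove ⟨m, hm2⟩
  have hinv' := mul_le_mul_of_nonneg_left hinv (sq_nonneg σ)
  exact sub_pos.2 ((hinv'.trans_lt hsq).trans_le hsup)

theorem stdGaussian_inner_chebyshev (h : EuclideanSpace ℝ (Fin n)) {a : ℝ} (ha : 0 < a) :
    (stdGaussian (EuclideanSpace ℝ (Fin n))).real {ε | a * ‖h‖ < |inner ℝ h ε|} ≤ 1 / a ^ 2 := by
  rcases eq_or_ne h 0 with rfl | hh
  · simp [sq_nonneg]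
  have hh' : 0 < ‖h‖ := norm_pos_iff.2 hh
  have hs : MeasurableSet {x : ℝ | a * ‖h‖ < |x|} :=
    measurableSet_lt measurable_const (by fun_prop)
  have hc := meas_ge_le_variance_div_sq (μ := gaussianReal 0 (‖h‖₊ ^ 2))
    (memLp_id_gaussianReal' 2 (by simp)) (mul_pos ha hh')
  rw [variance_id_gaussianReal] at hc
  have h0 : ∫ x, id x ∂gaussianReal 0 (‖h‖₊ ^ 2) = 0 := by simp
  rw [h0] at hc
  have hmap := map_measureReal_apply (μ := stdGaussian (EuclideanSpace ℝ (Fin n)))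
    (f := fun x => inner ℝ h x) (by fun_prop) hs
  rw [stdGaussian_map_inner] at hmap
  change (stdGaussian (EuclideanSpace ℝ (Fin n))).real
    ((fun x => inner ℝ h x) ⁻¹' {x : ℝ | a * ‖h‖ < |x|}) ≤ _
  rw [← hmap]
  refine ENNReal.toReal_le_of_le_ofReal (by positivity) ?_
  refine (measure_mono fun x hx => ?_).trans (hc.trans (ENNReal.ofReal_le_ofReal (le_of_eq ?_)))
  · simpa using (show a * ‖h‖ < |x| from hx).le
  · simp only [NNReal.coe_pow, coe_nnnorm]
    field_simp

theorem sqNormalVar_nonneg : 0 ≤ sqNormalVar := variance_nonneg _ _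

theorem chiSqTailInv_le_chebyshev {q s : ℝ} (hs : 0 < s) (h : n * sqNormalVar / s ^ 2 ≤ q) :
    chiSqTailInv n q ≤ n + s := by
  refine chiSqTailInv_le (by positivity) (le_trans (measureReal_mono fun x hx => ?_)
    ((stdGaussian_norm_sq_chebyshev n hs).trans h))
  have : n + s < ‖x‖ ^ 2 := hx
  exact (le_sub_iff_add_le'.2 this.le).trans (le_abs_self _)

/-- In `‖μ + σε‖² = ‖μ‖² + 2σ⟨μ,ε⟩ + σ²‖ε‖²`, half of `‖μ‖²` absorbs the cross term (`hμa`), and the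
other half absorbs the deviation `t` of `‖ε‖²` and the excess `s` of the quantile over `n` (`hμ`).
-/
theorem tStarFull_power {q σ δ a s t : ℝ} (hσ : 0 < σ) (μ : EuclideanSpace ℝ (Fin n))
    (ha : 0 < a) (hs : 0 < s) (ht : 0 < t)
    (hq : n * sqNormalVar / s ^ 2 ≤ q) (hδ : n * sqNormalVar / t ^ 2 + 1 / a ^ 2 ≤ δ)
    (hμa : 4 * a * σ ≤ ‖μ‖) (hμ : 2 * (s + t) * σ ^ 2 ≤ ‖μ‖ ^ 2) :
    1 - δ ≤ (stdGaussian (EuclideanSpace ℝ (Fin n))).real {ε | 0 < tStarFull q σ (μ + σ • ε)} := by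
  refine one_sub_le_measureReal_of_compl_subset
    (B := {ε | t ≤ |‖ε‖ ^ 2 - n|} ∪ {ε | a * ‖μ‖ < |inner ℝ μ ε|}) (fun ε hε => ?_)
    ((measureReal_union_le _ _).trans (le_trans (add_le_add (stdGaussian_norm_sq_chebyshev n ht)
      (stdGaussian_inner_chebyshev μ ha)) hδ))
  have h1 : |‖ε‖ ^ 2 - n| < t := not_le.1 fun h => hε (Or.inl h)
  have h2 : |inner ℝ μ ε| ≤ a * ‖μ‖ := not_lt.1 fun h => hε (Or.inr h)
  have h3 := chiSqTailInv_le_chebyshev hs hq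
  change 0 < ‖μ + σ • ε‖ ^ 2 - σ ^ 2 * _
  rw [norm_add_sq_real, inner_smul_right, norm_smul, Real.norm_of_nonneg hσ.le]
  have h4 := mul_le_mul_of_nonneg_left h3 (sq_nonneg σ)
  have h5 := mul_lt_mul_of_pos_left (abs_lt.1 h1).1 (sq_pos_of_pos hσ)
  have h6 := mul_le_mul_of_nonneg_left (abs_le.1 h2).1 hσ.le
  have h7 := mul_le_mul_of_nonneg_right hμa (norm_nonneg μ)
  nlinarith

end Model

/-! ### The upper bound for `T*` -/

theorem mul_testingRate {n : ℕ} (hn : 0 < n) (k p : ℕ) :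
    (n : ℝ) * testingRate k n p = min (k * Real.log p) √n := by
  have hn' : (0 : ℝ) < n := by exact_mod_cast hn
  rw [testingRate, mul_min_of_nonneg _ _ hn'.le]
  congr 1
  · field_simp
  · rw [mul_one_div, Real.div_sqrt]

theorem testingRate_pos {k n p : ℕ} (hn : 0 < n) (hk : 1 ≤ k) (hlog : 0 < Real.log p) :
    0 < testingRate k n p := by
  have hn' : (0 : ℝ) < n := by exact_mod_cast hn
  have hk' : (0 : ℝ) < k := by exact_mod_cast hk
  exact lt_min (by positivity) (by positivity)

/-- The constant of the upper bound. -/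
noncomputable def upperConstant (α δ : ℝ) : ℝ :=
  64 / δ + 4 * (√(2 * (sqNormalVar + 1) / α) + √(2 * (sqNormalVar + 1) / δ)) + 33 +
    8 * (Real.log (1 / δ) + Real.log (2 / α))

section Power

variable {n p k : ℕ} {α δ σ : ℝ}

theorem tStar_power_of_dense (hα : 0 < α) (hα1 : α ≤ 1) (hδ : 0 < δ) (hδ1 : δ ≤ 1) (hσ : 0 < σ)
    (hn : 0 < n) (μ : EuclideanSpace ℝ (Fin n))
    (hμ : upperConstant α δ * (√n / 2) * σ ^ 2 ≤ ‖μ‖ ^ 2) :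
    1 - δ ≤ (stdGaussian (EuclideanSpace ℝ (Fin n))).real
      {ε | 0 < tStarFull (α / 2) σ (μ + σ • ε)} := by
  have hκ := sqNormalVar_nonneg
  have hn1 : (1 : ℝ) ≤ n := by exact_mod_cast hn
  have hsn : 1 ≤ √(n : ℝ) := Real.one_le_sqrt.2 hn1
  have hsq : √(n : ℝ) ^ 2 = n := Real.sq_sqrt (by positivity)
  have hL1 : 0 ≤ Real.log (1 / δ) := Real.log_nonneg (by rw [le_div_iff₀ hδ]; linarith)
  have hL2 : 0 ≤ Real.log (2 / α) := Real.log_nonneg (by rw [le_div_iff₀ hα]; linarith)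
  set A := √(2 * (sqNormalVar + 1) / α) with hA
  set B := √(2 * (sqNormalVar + 1) / δ) with hB
  have hA0 : 0 < A := by positivity
  have hB0 : 0 < B := by positivity
  have hA2 : A ^ 2 = 2 * (sqNormalVar + 1) / α := Real.sq_sqrt (by positivity)
  have hB2 : B ^ 2 = 2 * (sqNormalVar + 1) / δ := Real.sq_sqrt (by positivity)
  have ha2 : √(2 / δ) ^ 2 = 2 / δ := Real.sq_sqrt (by positivity)
  have haux : ∀ x : ℝ, 0 < x →
      n * sqNormalVar / (n * (2 * (sqNormalVar + 1) / x)) ≤ x / 2 := fun x hx => by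
    rw [div_le_iff₀ (by positivity)]
    have : x / 2 * (n * (2 * (sqNormalVar + 1) / x)) = n * (sqNormalVar + 1) := by field_simp
    rw [this]
    nlinarith
  have hD : 64 / δ + 4 * (A + B) ≤ upperConstant α δ := by
    unfold upperConstant; linarith
  have hD0 : 0 < 64 / δ := by positivity
  -- The inner product and the norm each fail with probability at most `δ/2`. The `+ 1` inside `A`
  -- and `B` keeps `s` and `t` positive without evaluating the variance.
  refine tStarFull_power (a := √(2 / δ)) (s := √n * A) (t := √n * B) hσ μ (by positivity)
    (by positivity) (by positivity) ?_ ?_ ?_ ?_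
  · rw [mul_pow, hsq, hA2]; exact haux α hα
  · rw [mul_pow, hsq, hB2, ha2]
    have := haux δ hδ
    have h2 : 1 / (2 / δ) = δ / 2 := by field_simp
    linarith
  · refine le_of_sq_le_sq ?_ (norm_nonneg _)
    refine le_trans ?_ hμ
    rw [mul_pow, mul_pow, ha2]
    refine mul_le_mul_of_nonneg_right ?_ (sq_nonneg σ)
    have : (4 : ℝ) ^ 2 * (2 / δ) = 64 / δ * (1 / 2) := by ring
    rw [this]
    exact mul_le_mul (by linarith) (by linarith) (by norm_num) (by linarith)
  · refine le_trans (mul_le_mul_of_nonneg_right ?_ (sq_nonneg σ)) hμ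
    nlinarith

theorem tStar_power_of_sparse (hα : 0 < α) (hα1 : α ≤ 1) (hδ : 0 < δ) (hδ1 : δ ≤ 1) (hσ : 0 < σ)
    (X : Matrix (Fin n) (Fin p) ℝ) (hlog : 1 ≤ Real.log p) (hp : √n ≤ (p : ℝ)) (hp1 : 1 ≤ p)
    (hk : 1 ≤ k) (hkp : k ≤ p) {θ : Fin p → ℝ} (hθ : θ ∈ sparseVectors k p)
    (hμ : upperConstant α δ * (k * Real.log p) * σ ^ 2 ≤ ‖signal X θ‖ ^ 2) :
    1 - δ ≤ (stdGaussian (EuclideanSpace ℝ (Fin n))).real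
      {ε | 0 < tStarSparse (α / (2 * (kStar n p : ℝ))) k X σ (signal X θ + σ • ε)} := by
  have hL1 : 0 ≤ Real.log (1 / δ) := Real.log_nonneg (by rw [le_div_iff₀ hδ]; linarith)
  have hL2 : 0 ≤ Real.log (2 / α) := Real.log_nonneg (by rw [le_div_iff₀ hα]; linarith)
  have hK : (1 : ℝ) ≤ kStar n p := by exact_mod_cast (kStar_mem hp hp1).1
  have hC : 1 ≤ (p.choose k : ℝ) := by exact_mod_cast Nat.choose_pos hkp
  have hk1 : (1 : ℝ) ≤ k := by exact_mod_cast hk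
  have hp0 : (0 : ℝ) < p := by exact_mod_cast hp1
  have hlK : Real.log (kStar n p) ≤ Real.log p :=
    Real.log_le_log (by positivity) (by exact_mod_cast kStar_le hp hp1)
  have hlC : Real.log (p.choose k) ≤ k * Real.log p := by
    rw [← Real.log_pow]
    exact Real.log_le_log (by positivity) (by exact_mod_cast Nat.choose_le_pow p k)
  have hlK0 : 0 ≤ Real.log (kStar n p) := Real.log_nonneg hK
  have hlC0 : 0 ≤ Real.log (p.choose k) := Real.log_nonneg hC
  have hkl : 1 ≤ k * Real.log p := by nlinarith
  have hA : 0 ≤ 64 / δ := by positivity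
  set v := 4 * (k + (Real.log (2 / α) + Real.log (kStar n p) + Real.log (p.choose k))) with hv
  set u := 4 * (k + Real.log (1 / δ)) with hu
  have hv0 : 0 ≤ v := by positivity
  have hu0 : 0 ≤ u := by positivity
  refine tStarSparse_power (u := u) (v := v) hσ hkp hθ hv0 ?_ ?_ ?_
  · rw [← Real.le_log_iff_exp_le hδ, hu, one_div, Real.log_inv]
    linarith
  · rw [← Real.le_log_iff_exp_le (by positivity), Real.log_div (by positivity) (by positivity),
      Real.log_div (by positivity) (by positivity), Real.log_mul (by positivity) (by positivity), hv,
      Real.log_div (by positivity) (by positivity)]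
    linarith
  · refine lt_of_pow_lt_pow_left₀ 2 (norm_nonneg _) (lt_of_lt_of_le ?_ hμ)
    rw [mul_pow, mul_comm]
    refine mul_lt_mul_of_pos_right ?_ (by positivity)
    have h1 : (√u + √v) ^ 2 ≤ 2 * (u + v) := by
      nlinarith [sq_nonneg (√u - √v), Real.sq_sqrt hu0, Real.sq_sqrt hv0]
    have h2 : u + v ≤ (k * Real.log p) *
        (16 + 4 * (Real.log (1 / δ) + Real.log (2 / α))) := by
      have : (k : ℝ) ≤ k * Real.log p := by nlinarith
      have : Real.log p ≤ k * Real.log p := by nlinarith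
      have := mul_le_mul_of_nonneg_right hkl (add_nonneg hL1 hL2)
      rw [hu, hv]
      linarith
    -- The two previous bounds give `32`; the `33` makes the separation strict.
    have h3 : 33 + 8 * (Real.log (1 / δ) + Real.log (2 / α)) ≤ upperConstant α δ := by
      have : 0 ≤ √(2 * (sqNormalVar + 1) / α) := Real.sqrt_nonneg _
      have : 0 ≤ √(2 * (sqNormalVar + 1) / δ) := Real.sqrt_nonneg _
      unfold upperConstant; linarith
    have h4 := mul_le_mul_of_nonneg_right h3 (zero_le_one.trans hkl)
    linarith

/-- The split is at `√n = 2k log p`. Below it the minimum in the rate is at least `√n / 2`; above it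
the minimum is `k log p` and `k < k*`, so `k` is among the scanned sparsities. -/
theorem separationDistance_tStar_sq_le (hα : 0 < α) (hα1 : α ≤ 1) (hδ : 0 < δ) (hδ1 : δ ≤ 1)
    (hσ : 0 < σ) (X : Matrix (Fin n) (Fin p) ℝ) (hn : 0 < n) (hlog : 1 ≤ Real.log p)
    (hp : √n ≤ (p : ℝ)) (hk : 1 ≤ k) (hkp : k ≤ p) :
    separationDistance δ (tStar α X σ) k X σ ^ 2
      ≤ ENNReal.ofReal (upperConstant α δ * testingRate k n p) := by
  have hp1 : 1 ≤ p := hk.trans hkp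
  have hR := testingRate_pos hn hk (zero_lt_one.trans_le hlog)
  have hD : 0 < upperConstant α δ := by
    have hL1 : 0 ≤ Real.log (1 / δ) := Real.log_nonneg (by rw [le_div_iff₀ hδ]; linarith)
    have hL2 : 0 ≤ Real.log (2 / α) := Real.log_nonneg (by rw [le_div_iff₀ hα]; linarith)
    unfold upperConstant; positivity
  have hDR : 0 < upperConstant α δ * testingRate k n p := mul_pos hD hR
  rw [← Real.sq_sqrt hDR.le, ENNReal.ofReal_pow (Real.sqrt_nonneg _)]
  gcongr
  refine sInf_le ⟨_, Real.sqrt_pos.2 hDR, rfl, fun θ hθ hsep => ?_⟩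
  have hsep2 : upperConstant α δ * min (k * Real.log p) √n * σ ^ 2 ≤ ‖signal X θ‖ ^ 2 := by
    have := pow_le_pow_left₀ (by positivity) hsep 2
    rw [mul_pow, mul_pow, Real.sq_sqrt (by positivity), Real.sq_sqrt hDR.le] at this
    rw [← mul_testingRate hn]
    linarith
  rw [responseLaw_apply _ _ _ (measurableSet_lt measurable_const (measurable_tStar _ _ _)),
    ← ofReal_measureReal]
  refine ENNReal.ofReal_le_ofReal ?_
  rcases le_or_gt √n (2 * (k * Real.log p)) with h | h
  · have hmin : √n / 2 ≤ min (k * Real.log p) √n :=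
      le_min (by linarith) (by linarith [Real.sqrt_nonneg n])
    refine (tStar_power_of_dense hα hα1 hδ hδ1 hσ hn (signal X θ) (le_trans ?_ hsep2)).trans
      (measureReal_mono fun ε hε => tStar_pos_iff.2 (Or.inl hε))
    gcongr
  · have hkk : k < kStar n p := by
      by_contra hc
      exact absurd (sqrt_le_of_kStar_le hp hp1 hlog (not_lt.1 hc)) (not_le.2 h)
    have hmin : min (k * Real.log p) √n = k * Real.log p :=
      min_eq_left (by nlinarith [mul_nonneg (Nat.cast_nonneg (α := ℝ) k) (zero_le_one.trans hlog)])
    rw [hmin] at hsep2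
    exact (tStar_power_of_sparse hα hα1 hδ hδ1 hσ X hlog hp hp1 hk hkp hθ hsep2).trans
      (measureReal_mono fun ε hε =>
        tStar_pos_iff.2 (Or.inr ⟨k, Finset.mem_Ico.2 ⟨hk, hkk⟩, hε⟩))

end Power

/-! ### Gaussian shifts and the second-moment method -/

section Shift

variable {n : ℕ}

theorem integrable_exp_inner_stdGaussian (h : EuclideanSpace ℝ (Fin n)) :
    Integrable (fun x => Real.exp (inner ℝ h x)) (stdGaussian (EuclideanSpace ℝ (Fin n))) := by
  have h1 := integrable_exp_mul_gaussianReal (μ := 0) (v := ‖h‖₊ ^ 2) 1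
  rw [← stdGaussian_map_inner h, integrable_map_measure (by fun_prop) (by fun_prop)] at h1
  simpa [Function.comp_def] using h1

theorem integral_exp_inner_stdGaussian (h : EuclideanSpace ℝ (Fin n)) :
    ∫ x, Real.exp (inner ℝ h x) ∂stdGaussian (EuclideanSpace ℝ (Fin n))
      = Real.exp (‖h‖ ^ 2 / 2) := by
  have h1 := mgf_gaussianReal (stdGaussian_map_inner h) 1
  simpa [mgf] using h1

/-- The Cameron-Martin formula in `ℝ^n`. -/
theorem stdGaussian_map_const_add (h : EuclideanSpace ℝ (Fin n)) :
    (stdGaussian (EuclideanSpace ℝ (Fin n))).map (fun x => h + x)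
      = (stdGaussian (EuclideanSpace ℝ (Fin n))).tilted (fun x => inner ℝ h x) := by
  have := isProbabilityMeasure_tilted (integrable_exp_inner_stdGaussian h)
  have : IsProbabilityMeasure ((stdGaussian (EuclideanSpace ℝ (Fin n))).map (fun x => h + x)) :=
    Measure.isProbabilityMeasure_map (by fun_prop)
  apply Measure.ext_of_charFun
  ext t
  rw [charFun_map_const_add, charFun_stdGaussian, charFun_apply, integral_tilted,
    integral_exp_inner_stdGaussian, integral_stdGaussian_eq_pi]
  have hcoord : ∀ x : Fin n → ℝ,
      (Real.exp (inner ℝ h (WithLp.toLp 2 x)) / Real.exp (‖h‖ ^ 2 / 2)) •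
        Complex.exp (inner ℝ (WithLp.toLp 2 x) t * Complex.I)
      = Complex.exp (-(‖h‖ ^ 2 / 2)) *
        ∏ i, Complex.exp ((h i + t i * Complex.I) * x i) := fun x => by
    rw [← Real.exp_sub, Complex.real_smul, ← Complex.exp_sum, ← Complex.exp_add, Complex.ofReal_exp,
      ← Complex.exp_add]
    congr 1
    simp only [PiLp.inner_apply, RCLike.inner_apply, conj_trivial, Complex.ofReal_sub,
      Complex.ofReal_sum, Complex.ofReal_mul, Complex.ofReal_div, Complex.ofReal_pow,
      Complex.ofReal_ofNat, Finset.sum_mul, add_mul, Finset.sum_add_distrib]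
    rw [sub_add_eq_add_sub, sub_eq_neg_add]
    congr 2
    · exact Finset.sum_congr rfl fun i _ => by ring
    · exact Finset.sum_congr rfl fun i _ => by ring
  simp_rw [hcoord]
  rw [integral_const_mul, integral_fintype_prod_eq_prod
    (f := fun i (x : ℝ) => Complex.exp ((h i + t i * Complex.I) * x))]
  have hmgf : ∀ z : ℂ, ∫ x : ℝ, Complex.exp (z * x) ∂gaussianReal 0 1 = Complex.exp (z ^ 2 / 2) :=
    fun z => by simpa [complexMGF] using complexMGF_id_gaussianReal (μ := 0) (v := 1) z
  simp_rw [hmgf]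
  rw [← Complex.exp_sum, ← Complex.exp_add, ← Complex.exp_add]
  congr 1
  have hh : ((‖h‖ : ℂ)) ^ 2 = ∑ i, (h i : ℂ) ^ 2 := by
    exact_mod_cast EuclideanSpace.real_norm_sq_eq h
  have ht : ((‖t‖ : ℂ)) ^ 2 = ∑ i, (t i : ℂ) ^ 2 := by
    exact_mod_cast EuclideanSpace.real_norm_sq_eq t
  rw [hh, ht]
  simp only [PiLp.inner_apply, RCLike.inner_apply, conj_trivial, Complex.ofReal_sum,
    Complex.ofReal_mul, Finset.sum_mul, Finset.sum_div, ← Finset.sum_neg_distrib,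
    ← Finset.sum_add_distrib]
  refine Finset.sum_congr rfl fun i _ => ?_
  linear_combination (-(t i : ℂ) ^ 2 / 2) * Complex.I_sq

theorem stdGaussian_real_shift (h : EuclideanSpace ℝ (Fin n))
    {A : Set (EuclideanSpace ℝ (Fin n))} (hA : MeasurableSet A) :
    (stdGaussian (EuclideanSpace ℝ (Fin n))).real {ε | h + ε ∈ A}
      = ∫ x in A, Real.exp (inner ℝ h x - ‖h‖ ^ 2 / 2)
          ∂stdGaussian (EuclideanSpace ℝ (Fin n)) := by
  have h1 := map_measureReal_apply (μ := stdGaussian (EuclideanSpace ℝ (Fin n)))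
    (f := fun x => h + x) (by fun_prop) hA
  rw [stdGaussian_map_const_add] at h1
  change _ = (stdGaussian (EuclideanSpace ℝ (Fin n))).real ((fun x => h + x) ⁻¹' A) at h1
  change (stdGaussian (EuclideanSpace ℝ (Fin n))).real ((fun x => h + x) ⁻¹' A) = _
  rw [← h1, measureReal_def, tilted_apply_eq_ofReal_integral, integral_exp_inner_stdGaussian,
    ENNReal.toReal_ofReal (integral_nonneg fun x => by positivity)]
  simp_rw [Real.exp_sub]

/-- A uniform mixture of Gaussian shifts whose likelihood ratio has second moment at most `2`
cannot be told from the standard Gaussian law by a test with error probabilities summing to at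
most `33%`. -/
theorem two_mul_card_sq_lt_sum_exp_inner {ι : Type*} (G : Finset ι) (hG : G.Nonempty)
    (h : ι → EuclideanSpace ℝ (Fin n)) {A : Set (EuclideanSpace ℝ (Fin n))}
    (hA : MeasurableSet A) {α δ : ℝ} (hδ : 0 ≤ δ) (hαδ : α + δ ≤ 33 / 100)
    (h0 : (stdGaussian (EuclideanSpace ℝ (Fin n))).real A ≤ α)
    (h1 : ∀ J ∈ G, 1 - δ ≤ (stdGaussian (EuclideanSpace ℝ (Fin n))).real {ε | h J + ε ∈ A}) :
    2 * (G.card : ℝ) ^ 2 < ∑ J ∈ G, ∑ J' ∈ G, Real.exp (inner ℝ (h J) (h J')) := by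
  set γ := stdGaussian (EuclideanSpace ℝ (Fin n))
  set M : ℝ := (G.card : ℝ) with hMdef
  have hM : 0 < M := Nat.cast_pos.2 hG.card_pos
  let L : ι → EuclideanSpace ℝ (Fin n) → ℝ := fun J x => Real.exp (inner ℝ (h J) x - ‖h J‖ ^ 2 / 2)
  have hLint : ∀ J, Integrable (L J) γ := fun J => by
    simp only [L, Real.exp_sub]
    exact (integrable_exp_inner_stdGaussian _).div_const _
  have hLone : ∀ J, ∫ x, L J x ∂γ = 1 := fun J => by
    simp only [L, Real.exp_sub]
    rw [integral_div, integral_exp_inner_stdGaussian, div_self (Real.exp_pos _).ne']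
  have hLL : ∀ J J' x, L J x * L J' x
      = Real.exp (inner ℝ (h J + h J') x) * Real.exp (-(‖h J‖ ^ 2 / 2) - ‖h J'‖ ^ 2 / 2) :=
    fun J J' x => by
      simp only [L]
      rw [← Real.exp_add, ← Real.exp_add, inner_add_left]
      congr 1; ring
  have hLLint : ∀ J J', Integrable (fun x => L J x * L J' x) γ := fun J J' => by
    simp_rw [hLL]
    exact (integrable_exp_inner_stdGaussian _).mul_const _
  have hLLval : ∀ J J', ∫ x, L J x * L J' x ∂γ = Real.exp (inner ℝ (h J) (h J')) := fun J J' => by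
    simp_rw [hLL]
    rw [integral_mul_const, integral_exp_inner_stdGaussian, ← Real.exp_add, norm_add_sq_real]
    congr 1; ring
  let W : EuclideanSpace ℝ (Fin n) → ℝ := fun x => ∑ J ∈ G, L J x
  have hWint : Integrable W γ := integrable_finsetSum _ fun J _ => hLint J
  have hWone : ∫ x, W x ∂γ = M := by
    simp only [W]
    rw [integral_finsetSum _ fun J _ => hLint J]
    simp [hLone, hMdef]
  have hWsq : ∀ x, W x ^ 2 = ∑ J ∈ G, ∑ J' ∈ G, L J x * L J' x := fun x => by
    rw [sq, Finset.sum_mul_sum]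
  have hWsqint : Integrable (fun x => W x ^ 2) γ := by
    simp_rw [hWsq]
    exact integrable_finsetSum _ fun J _ => integrable_finsetSum _ fun J' _ => hLLint J J'
  have hWsqval : ∫ x, W x ^ 2 ∂γ = ∑ J ∈ G, ∑ J' ∈ G, Real.exp (inner ℝ (h J) (h J')) := by
    simp_rw [hWsq]
    rw [integral_finsetSum _ fun J _ => integrable_finsetSum _ fun J' _ => hLLint J J']
    refine Finset.sum_congr rfl fun J _ => ?_
    rw [integral_finsetSum _ fun J' _ => hLLint J J']
    exact Finset.sum_congr rfl fun J' _ => hLLval J J'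
  rw [← hWsqval]
  have hWA : M * (1 - δ) ≤ ∫ x in A, W x ∂γ := by
    simp only [W]
    rw [integral_finsetSum _ fun J _ => (hLint J).integrableOn, ← nsmul_eq_mul]
    refine Finset.card_nsmul_le_sum _ _ _ fun J hJ => ?_
    exact (h1 J hJ).trans_eq (stdGaussian_real_shift _ hA)
  have hQint : Integrable (fun x => (W x - M) ^ 2) γ := by
    have : (fun x => (W x - M) ^ 2) = fun x => W x ^ 2 - 2 * M * W x + M ^ 2 := by
      ext x; ring
    rw [this]
    exact (hWsqint.sub (hWint.const_mul _)).add (integrable_const _)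
  have hQval : ∫ x, (W x - M) ^ 2 ∂γ = ∫ x, W x ^ 2 ∂γ - M ^ 2 := by
    have : (fun x => (W x - M) ^ 2) = fun x => W x ^ 2 - 2 * M * W x + M ^ 2 := by
      ext x; ring
    rw [this, integral_add (f := fun x => W x ^ 2 - 2 * M * W x)
      (hWsqint.sub (hWint.const_mul _)) (integrable_const _),
      integral_sub hWsqint (hWint.const_mul _), integral_const_mul, hWone]
    simp
    ring
  -- This is `(W - 2M)² ≥ 0`. With these weights, `1 - δ - 3α/2 ≥ 101/200`, so the variance of `W`
  -- is at least `101/100 * M²`, just above what is needed.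
  have hcmp : ∫ x in A, M * W x ∂γ ≤ ∫ x in A, (3 / 2 * M ^ 2 + 1 / 2 * (W x - M) ^ 2) ∂γ := by
    refine setIntegral_mono (hWint.const_mul _).integrableOn
      ((integrable_const _).add (hQint.const_mul _)).integrableOn fun x => ?_
    change M * W x ≤ 3 / 2 * M ^ 2 + 1 / 2 * (W x - M) ^ 2
    nlinarith [sq_nonneg (W x - M - M)]
  rw [integral_add (integrable_const _) (hQint.const_mul _).integrableOn, integral_const_mul,
    integral_const_mul, setIntegral_const, smul_eq_mul, integral_const_mul] at hcmp
  have hQA : ∫ x in A, (W x - M) ^ 2 ∂γ ≤ ∫ x, (W x - M) ^ 2 ∂γ :=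
    setIntegral_le_integral hQint (.of_forall fun x => sq_nonneg _)
  have hMM := sq_pos_of_pos hM
  have h2 := mul_le_mul_of_nonneg_left hWA hM.le
  have h3 := mul_le_mul_of_nonneg_right h0 hMM.le
  have h4 : 101 / 200 * M ^ 2 ≤ (1 - δ - 3 / 2 * α) * M ^ 2 :=
    mul_le_mul_of_nonneg_right (by linarith) hMM.le
  linarith

end Shift

/-- Lower bound on the minimax separation distance from a finite family of sparse vectors. -/
theorem le_minimaxSeparation_sq {n p k : ℕ} {α δ σ R : ℝ} (hα : 0 ≤ α) (hδ : 0 ≤ δ)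
    (hαδ : α + δ ≤ 33 / 100) (hσ : 0 < σ) (hR : 0 ≤ R) (X : Matrix (Fin n) (Fin p) ℝ)
    {ι : Type*} (G : Finset ι) (hG : G.Nonempty) (θ : ι → Fin p → ℝ)
    (hθ : ∀ J ∈ G, θ J ∈ sparseVectors k p) (hsep : ∀ J ∈ G, n * R ≤ ‖signal X (θ J)‖ ^ 2)
    (hsum : ∑ J ∈ G, ∑ J' ∈ G, Real.exp (inner ℝ (signal X (θ J)) (signal X (θ J')))
      ≤ 2 * (G.card : ℝ) ^ 2) :
    ENNReal.ofReal R ≤ minimaxSeparation α δ k X σ ^ 2 := by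
  rw [← Real.sq_sqrt hR, ENNReal.ofReal_pow (Real.sqrt_nonneg _)]
  gcongr
  refine le_iInf₂ fun Φ hΦ => le_sInf ?_
  rintro _ ⟨ρ, hρ, rfl, hpow⟩
  refine ENNReal.ofReal_le_ofReal ?_
  by_contra hlt
  rw [not_le] at hlt
  have hset : MeasurableSet {y | 0 < Φ y} := measurableSet_lt measurable_const hΦ.1
  -- Scaling the family by `σ` and reading the test as `ε ↦ Φ (σ • ε)` reduces everything to unit
  -- noise.
  have hsig : ∀ J, signal X (σ • θ J) = σ • signal X (θ J) := fun J => by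
    simp [signal, Matrix.mulVec_smul]
  have hA : MeasurableSet {ε : EuclideanSpace ℝ (Fin n) | 0 < Φ (σ • ε)} :=
    measurableSet_lt measurable_const (hΦ.1.comp (by fun_prop))
  refine absurd hsum (not_le.2 (two_mul_card_sq_lt_sum_exp_inner G hG _ hA hδ hαδ ?_ ?_))
  · have := hΦ.2
    rw [responseLaw_apply _ _ _ hset, signal_zero] at this
    simp only [zero_add] at this
    exact ENNReal.toReal_le_of_le_ofReal hα this
  · intro J hJ
    have hsp : σ • θ J ∈ sparseVectors k p := by
      have := hθ J hJ
      simpa [sparseVectors, hσ.ne'] using this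
    have hb := hpow _ hsp (by
      rw [hsig, norm_smul, Real.norm_of_nonneg hσ.le, mul_comm]
      refine mul_le_mul_of_nonneg_left ?_ hσ.le
      refine (mul_le_mul_of_nonneg_left hlt.le (Real.sqrt_nonneg _)).trans ?_
      rw [← Real.sqrt_mul (Nat.cast_nonneg n)]
      exact (Real.sqrt_le_left (norm_nonneg _)).2 (hsep J hJ))
    rw [responseLaw_apply _ _ _ hset, hsig] at hb
    simp only [← smul_add] at hb
    exact (ENNReal.ofReal_le_iff_le_toReal (measure_ne_top _ _)).1 hb

/-! ### Exponential moments of products of Gaussian variables -/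

theorem exp_le_one_add_add_sq_mul_exp_abs (x : ℝ) :
    Real.exp x ≤ 1 + x + x ^ 2 * Real.exp |x| := by
  have h1 : 1 ≤ Real.exp |x| := Real.one_le_exp (abs_nonneg x)
  have h2 : x ^ 2 ≤ x ^ 2 * Real.exp |x| := le_mul_of_one_le_right (sq_nonneg x) h1
  rcases le_or_gt |x| 1 with h | h
  · linarith [(abs_le.1 (Real.abs_exp_sub_one_sub_id_le h)).2]
  · rcases lt_abs.1 h with h3 | h3
    · have := le_mul_of_one_le_left (Real.exp_pos |x|).le (show 1 ≤ x ^ 2 by nlinarith)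
      have := Real.exp_le_exp.2 (le_abs_self x)
      linarith
    · have := Real.exp_le_one_iff.2 (show x ≤ 0 by linarith)
      nlinarith

/-- The linear term is kept exact, since its Gaussian mean is the inner product that drives the
lower bound. The remainder is separated in `a` and `b` by AM-GM, so that no joint law is needed; `Λ
≤ 1/8` leaves room to absorb `x ^ 4` in `exp (x²/4)`. -/
theorem exp_mul_le_of_le_eighth {Λ : ℝ} (h0 : 0 ≤ Λ) (h8 : Λ ≤ 1 / 8) (a b : ℝ) :
    Real.exp (Λ * (a * b)) ≤ 1 + Λ * (a * b)
      + 64 * Λ ^ 2 * (Real.exp (a ^ 2 / 4) + Real.exp (b ^ 2 / 4)) := by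
  have hquart : ∀ x : ℝ, x ^ 4 ≤ 128 * Real.exp (x ^ 2 / 8) := fun x => by
    have := Real.quadratic_le_exp_of_nonneg (show 0 ≤ x ^ 2 / 8 by positivity)
    nlinarith [sq_nonneg x]
  have hexp : ∀ x : ℝ, x ^ 2 * Real.exp (Λ * x ^ 2 / 2) * (x ^ 2 * Real.exp (Λ * x ^ 2 / 2))
      ≤ 128 * Real.exp (x ^ 2 / 4) := fun x => by
    calc x ^ 2 * Real.exp (Λ * x ^ 2 / 2) * (x ^ 2 * Real.exp (Λ * x ^ 2 / 2))
        = x ^ 4 * Real.exp (Λ * x ^ 2) := by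
          rw [mul_mul_mul_comm, ← Real.exp_add]; ring_nf
      _ ≤ 128 * Real.exp (x ^ 2 / 8) * Real.exp (x ^ 2 / 8) :=
          mul_le_mul (hquart x) (Real.exp_le_exp.2 (by nlinarith [sq_nonneg x]))
            (Real.exp_pos _).le (by positivity)
      _ = _ := by rw [mul_assoc, ← Real.exp_add]; ring_nf
  have habs : |Λ * (a * b)| ≤ Λ * a ^ 2 / 2 + Λ * b ^ 2 / 2 := by
    rw [abs_mul, abs_of_nonneg h0, abs_mul]
    nlinarith [mul_nonneg h0 (sq_nonneg (|a| - |b|)), sq_abs a, sq_abs b]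
  refine (exp_le_one_add_add_sq_mul_exp_abs _).trans ?_
  have h1 : Real.exp |Λ * (a * b)|
      ≤ Real.exp (Λ * a ^ 2 / 2) * Real.exp (Λ * b ^ 2 / 2) := by
    rw [← Real.exp_add]; exact Real.exp_le_exp.2 habs
  have h2 : (Λ * (a * b)) ^ 2 * Real.exp |Λ * (a * b)|
      ≤ Λ ^ 2 * ((a ^ 2 * Real.exp (Λ * a ^ 2 / 2)) * (b ^ 2 * Real.exp (Λ * b ^ 2 / 2))) := by
    calc _ ≤ (Λ * (a * b)) ^ 2 * (Real.exp (Λ * a ^ 2 / 2) * Real.exp (Λ * b ^ 2 / 2)) :=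
          mul_le_mul_of_nonneg_left h1 (sq_nonneg _)
      _ = _ := by ring
  have h3 := mul_le_mul_of_nonneg_left (two_mul_le_add_sq (a ^ 2 * Real.exp (Λ * a ^ 2 / 2))
    (b ^ 2 * Real.exp (Λ * b ^ 2 / 2))) (sq_nonneg Λ)
  have h4 := mul_le_mul_of_nonneg_left (hexp a) (sq_nonneg Λ)
  have h5 := mul_le_mul_of_nonneg_left (hexp b) (sq_nonneg Λ)
  linarith

section GaussianMoments

variable {p : ℕ}

theorem stdGaussian_map_inner_of_norm_one {h : EuclideanSpace ℝ (Fin p)} (hh : ‖h‖ = 1) :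
    (stdGaussian (EuclideanSpace ℝ (Fin p))).map (fun x => inner ℝ h x) = gaussianReal 0 1 := by
  rw [stdGaussian_map_inner]
  congr 1
  ext; simp [hh]

theorem integrable_exp_inner_sq {h : EuclideanSpace ℝ (Fin p)} (hh : ‖h‖ = 1) :
    Integrable (fun x => Real.exp (inner ℝ h x ^ 2 / 4))
      (stdGaussian (EuclideanSpace ℝ (Fin p))) := by
  have := integrable_exp_sq_div_four
  rw [← stdGaussian_map_inner_of_norm_one hh,
    integrable_map_measure (by fun_prop) (by fun_prop)] at this
  exact this

theorem integral_exp_inner_sq {h : EuclideanSpace ℝ (Fin p)} (hh : ‖h‖ = 1) :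
    ∫ x, Real.exp (inner ℝ h x ^ 2 / 4) ∂stdGaussian (EuclideanSpace ℝ (Fin p)) = √2 := by
  have := integral_exp_sq_div_four
  rwa [← stdGaussian_map_inner_of_norm_one hh, integral_map (by fun_prop) (by fun_prop)] at this

theorem integrable_inner_sq (h : EuclideanSpace ℝ (Fin p)) :
    Integrable (fun x => inner ℝ h x ^ 2) (stdGaussian (EuclideanSpace ℝ (Fin p))) := by
  have := (memLp_id_gaussianReal' (μ := 0) (v := ‖h‖₊ ^ 2) 2 (by simp)).integrable_sq
  rw [← stdGaussian_map_inner, integrable_map_measure (by fun_prop) (by fun_prop)] at this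
  exact this

theorem integral_inner_sq (h : EuclideanSpace ℝ (Fin p)) :
    ∫ x, inner ℝ h x ^ 2 ∂stdGaussian (EuclideanSpace ℝ (Fin p)) = ‖h‖ ^ 2 := by
  have hv := variance_id_gaussianReal (μ := 0) (v := ‖h‖₊ ^ 2)
  rw [variance_eq_sub (memLp_id_gaussianReal' 2 (by simp))] at hv
  have h2 : ∫ x, x ^ 2 ∂gaussianReal 0 (‖h‖₊ ^ 2) = ‖h‖ ^ 2 := by simpa using hv
  rwa [← stdGaussian_map_inner, integral_map (by fun_prop) (by fun_prop)] at h2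

theorem inner_mul_inner_eq (h h' x : EuclideanSpace ℝ (Fin p)) :
    inner ℝ h x * inner ℝ h' x
      = (inner ℝ (h + h') x ^ 2 - inner ℝ h x ^ 2 - inner ℝ h' x ^ 2) / 2 := by
  rw [inner_add_left]; ring

theorem integrable_inner_mul_inner (h h' : EuclideanSpace ℝ (Fin p)) :
    Integrable (fun x => inner ℝ h x * inner ℝ h' x)
      (stdGaussian (EuclideanSpace ℝ (Fin p))) := by
  simp_rw [inner_mul_inner_eq]
  exact (((integrable_inner_sq _).sub (integrable_inner_sq _)).sub
    (integrable_inner_sq _)).div_const 2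

theorem integral_inner_mul_inner (h h' : EuclideanSpace ℝ (Fin p)) :
    ∫ x, inner ℝ h x * inner ℝ h' x ∂stdGaussian (EuclideanSpace ℝ (Fin p)) = inner ℝ h h' := by
  simp_rw [inner_mul_inner_eq]
  rw [integral_div, integral_sub (f := fun x => inner ℝ (h + h') x ^ 2 - inner ℝ h x ^ 2)
      ((integrable_inner_sq _).sub (integrable_inner_sq _))
    (integrable_inner_sq _), integral_sub (integrable_inner_sq _) (integrable_inner_sq _)]
  simp_rw [integral_inner_sq]
  rw [norm_add_sq_real]; ring

variable {Λ : ℝ} {h h' : EuclideanSpace ℝ (Fin p)}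

theorem integrable_exp_mul_inner_bound (hh : ‖h‖ = 1) (hh' : ‖h'‖ = 1) :
    Integrable (fun x => 1 + Λ * (inner ℝ h x * inner ℝ h' x)
      + 64 * Λ ^ 2 * (Real.exp (inner ℝ h x ^ 2 / 4) + Real.exp (inner ℝ h' x ^ 2 / 4)))
      (stdGaussian (EuclideanSpace ℝ (Fin p))) :=
  ((integrable_const _).add ((integrable_inner_mul_inner h h').const_mul _)).add
    (((integrable_exp_inner_sq hh).add (integrable_exp_inner_sq hh')).const_mul _)

theorem integrable_exp_mul_inner (h0 : 0 ≤ Λ) (h8 : Λ ≤ 1 / 8) (hh : ‖h‖ = 1) (hh' : ‖h'‖ = 1) :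
    Integrable (fun x => Real.exp (Λ * (inner ℝ h x * inner ℝ h' x)))
      (stdGaussian (EuclideanSpace ℝ (Fin p))) := by
  refine (integrable_exp_mul_inner_bound (Λ := Λ) hh hh').mono' (by fun_prop)
    (.of_forall fun x => ?_)
  rw [Real.norm_of_nonneg (Real.exp_pos _).le]
  exact exp_mul_le_of_le_eighth h0 h8 _ _

/-- Integrating the pointwise bound gives the remainder `128√2 Λ² ≤ 200Λ²`; then `1 + x ≤ exp x`
puts it in a form that multiplies over rows. -/
theorem integral_exp_mul_inner_le (h0 : 0 ≤ Λ) (h8 : Λ ≤ 1 / 8) (hh : ‖h‖ = 1) (hh' : ‖h'‖ = 1) :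
    ∫ x, Real.exp (Λ * (inner ℝ h x * inner ℝ h' x)) ∂stdGaussian (EuclideanSpace ℝ (Fin p))
      ≤ Real.exp (Λ * inner ℝ h h' + 200 * Λ ^ 2) := by
  have h1 := integral_mono (integrable_exp_mul_inner h0 h8 hh hh')
    (integrable_exp_mul_inner_bound (Λ := Λ) hh hh')
    (fun x => exp_mul_le_of_le_eighth h0 h8 _ _)
  rw [integral_add (f := fun x => 1 + Λ * (inner ℝ h x * inner ℝ h' x))
      ((integrable_const _).add ((integrable_inner_mul_inner h h').const_mul _))
      (g := fun x => 64 * Λ ^ 2 *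
        (Real.exp (inner ℝ h x ^ 2 / 4) + Real.exp (inner ℝ h' x ^ 2 / 4)))
      (((integrable_exp_inner_sq hh).add (integrable_exp_inner_sq hh')).const_mul _),
    integral_add (integrable_const _) ((integrable_inner_mul_inner h h').const_mul _),
    integral_const_mul, integral_const_mul, integral_inner_mul_inner,
    integral_add (integrable_exp_inner_sq hh) (integrable_exp_inner_sq hh'),
    integral_exp_inner_sq hh, integral_exp_inner_sq hh'] at h1
  have h2 : √(2 : ℝ) ≤ 3 / 2 := (Real.sqrt_le_left (by norm_num)).2 (by norm_num)
  have h3 := mul_le_mul_of_nonneg_left h2 (sq_nonneg Λ)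
  have h4 := Real.add_one_le_exp (Λ * inner ℝ h h' + 200 * Λ ^ 2)
  simp only [integral_const, probReal_univ, one_smul] at h1
  refine h1.trans (le_trans ?_ h4)
  nlinarith [sq_nonneg Λ]

end GaussianMoments

/-! ### Gaussian designs -/

section Design

variable {n p : ℕ}

instance isProbabilityMeasure_gaussianDesign : IsProbabilityMeasure (gaussianDesign n p) := by
  unfold gaussianDesign; infer_instance

theorem signal_of_apply (A : Fin n → Fin p → ℝ) (u : EuclideanSpace ℝ (Fin p)) (i : Fin n) :
    signal (Matrix.of A) u i = inner ℝ u (WithLp.toLp 2 (A i)) := by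
  simp [signal, Matrix.mulVec, dotProduct, PiLp.inner_apply]

theorem measurable_signal_of (u : EuclideanSpace ℝ (Fin p)) :
    Measurable fun A : Fin n → Fin p → ℝ => signal (Matrix.of A) u := by
  have : (fun A : Fin n → Fin p → ℝ => signal (Matrix.of A) u)
      = fun A => WithLp.toLp 2 fun i => inner ℝ u (WithLp.toLp 2 (A i)) := by
    ext A i; exact signal_of_apply A u i
  rw [this]
  fun_prop

/-- Each factor depends on one row only, so the expectation over independent rows becomes an `n`-th
power. -/
theorem exp_inner_signal (A : Fin n → Fin p → ℝ) (Λ : ℝ) (u v : EuclideanSpace ℝ (Fin p)) :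
    Real.exp (Λ * inner ℝ (signal (Matrix.of A) u) (signal (Matrix.of A) v))
      = ∏ i, Real.exp (Λ * (inner ℝ u (WithLp.toLp 2 (A i)) * inner ℝ v (WithLp.toLp 2 (A i)))) := by
  rw [← Real.exp_sum, ← Finset.mul_sum, PiLp.inner_apply]
  simp_rw [signal_of_apply]
  simp [mul_comm]

variable {Λ : ℝ} {u v : EuclideanSpace ℝ (Fin p)}

theorem integrable_exp_inner_signal (h0 : 0 ≤ Λ) (h8 : Λ ≤ 1 / 8) (hu : ‖u‖ = 1) (hv : ‖v‖ = 1) :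
    Integrable (fun A : Fin n → Fin p → ℝ =>
      Real.exp (Λ * inner ℝ (signal (Matrix.of A) u) (signal (Matrix.of A) v)))
      (gaussianDesign n p) := by
  simp_rw [exp_inner_signal]
  have := integrable_exp_mul_inner h0 h8 hu hv
  rw [← (stdGaussian_measurePreserving_toLp p).integrable_comp_emb
    (MeasurableEquiv.toLp 2 (Fin p → ℝ)).measurableEmbedding] at this
  exact Integrable.fintype_prod fun _ => this

theorem integral_exp_inner_signal_le (h0 : 0 ≤ Λ) (h8 : Λ ≤ 1 / 8) (hu : ‖u‖ = 1)
    (hv : ‖v‖ = 1) :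
    ∫ A, Real.exp (Λ * inner ℝ (signal (Matrix.of A) u) (signal (Matrix.of A) v))
      ∂gaussianDesign n p ≤ Real.exp (n * (Λ * inner ℝ u v + 200 * Λ ^ 2)) := by
  simp_rw [exp_inner_signal]
  have h := integral_exp_mul_inner_le h0 h8 hu hv
  rw [integral_stdGaussian_eq_pi] at h
  rw [gaussianDesign, integral_fintype_prod_eq_pow (f := fun x : Fin p → ℝ =>
    Real.exp (Λ * (inner ℝ u (WithLp.toLp 2 x) * inner ℝ v (WithLp.toLp 2 x)))),
    Fintype.card_fin, Real.exp_nat_mul]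
  exact pow_le_pow_left₀ (integral_nonneg fun x => (Real.exp_pos _).le) h n

/-- The image of a unit vector by a Gaussian design is standard Gaussian. -/
theorem gaussianDesign_map_signal (hu : ‖u‖ = 1) :
    (gaussianDesign n p).map (fun A => signal (Matrix.of A) u)
      = stdGaussian (EuclideanSpace ℝ (Fin n)) := by
  have hrow : (Measure.pi fun _ : Fin p => gaussianReal 0 1).map
      (fun x => inner ℝ u (WithLp.toLp 2 x)) = gaussianReal 0 1 := by
    have := stdGaussian_map_inner_of_norm_one hu
    rw [← map_pi_eq_stdGaussian, Measure.map_map (by fun_prop) (by fun_prop)] at this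
    exact this
  have hfun : (fun A : Fin n → Fin p → ℝ => signal (Matrix.of A) u)
      = WithLp.toLp 2 ∘ fun A i => inner ℝ u (WithLp.toLp 2 (A i)) := by
    ext A i; exact signal_of_apply A u i
  have hsf : ∀ _ : Fin n, SigmaFinite ((Measure.pi fun _ : Fin p => gaussianReal 0 1).map
      (fun x => inner ℝ u (WithLp.toLp 2 x))) := fun _ => by rw [hrow]; infer_instance
  rw [hfun, ← Measure.map_map (by fun_prop) (by fun_prop), gaussianDesign,
    Measure.pi_map_pi (hμ := hsf) (fun _ => by fun_prop), ← map_pi_eq_stdGaussian]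
  simp_rw [hrow]

theorem gaussianDesign_norm_signal_le (hn : 0 < n) (hu : ‖u‖ = 1) :
    (gaussianDesign n p).real {A | ‖signal (Matrix.of A) u‖ ^ 2 ≤ n / 2}
      ≤ 4 * sqNormalVar / n := by
  have hn' : (0 : ℝ) < n := by exact_mod_cast hn
  have hset : MeasurableSet {x : EuclideanSpace ℝ (Fin n) | ‖x‖ ^ 2 ≤ n / 2} :=
    measurableSet_le (by fun_prop) measurable_const
  have h := map_measureReal_apply (μ := gaussianDesign n p) (measurable_signal_of u) hset
  rw [gaussianDesign_map_signal hu] at h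
  refine (h.symm.le.trans (measureReal_mono fun x hx => ?_)).trans
    ((stdGaussian_norm_sq_chebyshev n (half_pos hn')).trans (le_of_eq (by field_simp; norm_num)))
  have hx' : ‖x‖ ^ 2 ≤ n / 2 := hx
  change (n : ℝ) / 2 ≤ |‖x‖ ^ 2 - n|
  rw [abs_sub_comm]
  exact le_trans (by linarith) (le_abs_self _)

end Design

/-! ### From average designs to typical designs -/

section Markov

theorem measureReal_ge_le_of_integral_le {Ω : Type*} [MeasurableSpace Ω] {μ : Measure Ω}
    {f : Ω → ℝ} (hf : 0 ≤ f) (hint : Integrable f μ) {a b : ℝ} (ha : 0 < a)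
    (h : ∫ ω, f ω ∂μ ≤ a * b) : μ.real {ω | a ≤ f ω} ≤ b :=
  le_of_mul_le_mul_left
    ((mul_meas_ge_le_integral_of_nonneg (.of_forall hf) hint a).trans h) ha

end Markov

section Family

variable {n p k : ℕ} {ι : Type*} [Fintype ι] {α δ η Λ : ℝ}
  {u : ι → EuclideanSpace ℝ (Fin p)}

/-- Apply `1 + x ≤ exp x` and note that the inner products sum to `‖∑ w‖² ≥ 0`. Thus the second
moment minus one is nonnegative for every design, and Markov's inequality can exploit its small
mean. -/
theorem card_sq_le_sum_exp_inner [Nonempty ι] {E : Type*} [NormedAddCommGroup E] [InnerProductSpace ℝ E]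
    (hΛ : 0 ≤ Λ) (w : ι → E) :
    (Fintype.card ι : ℝ) ^ 2 ≤ ∑ J, ∑ J', Real.exp (Λ * inner ℝ (w J) (w J')) := by
  have h1 : ∑ J, ∑ J', (Λ * inner ℝ (w J) (w J') + 1)
      ≤ ∑ J, ∑ J', Real.exp (Λ * inner ℝ (w J) (w J')) :=
    Finset.sum_le_sum fun J _ => Finset.sum_le_sum fun J' _ => Real.add_one_le_exp _
  have h2 : ∑ J, ∑ J', (Λ * inner ℝ (w J) (w J') + 1)
      = Λ * ‖∑ J, w J‖ ^ 2 + (Fintype.card ι : ℝ) ^ 2 := by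
    rw [← real_inner_self_eq_norm_sq, sum_inner]
    simp_rw [inner_sum, Finset.sum_add_distrib, Finset.mul_sum]
    simp [sq]
  rw [h2] at h1
  have := mul_nonneg hΛ (sq_nonneg ‖∑ J, w J‖)
  linarith

/-- The second moment of the likelihood ratio of the mixture is close to one for most designs. -/
theorem gaussianDesign_sum_exp_ge [Nonempty ι] (h0 : 0 ≤ Λ) (h8 : Λ ≤ 1 / 8) (hu : ∀ J, ‖u J‖ = 1)
    (hsum : ∑ J, ∑ J', Real.exp (n * (Λ * inner ℝ (u J) (u J') + 200 * Λ ^ 2))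
      ≤ (1 + η / 4) * (Fintype.card ι : ℝ) ^ 2) :
    (gaussianDesign n p).real {A | 1 / 2 * (Fintype.card ι : ℝ) ^ 2
      ≤ ∑ J, ∑ J', Real.exp (Λ * inner ℝ (signal (Matrix.of A) (u J)) (signal (Matrix.of A) (u J')))
        - (Fintype.card ι : ℝ) ^ 2} ≤ η / 2 := by
  have hM : (0 : ℝ) < Fintype.card ι := by exact_mod_cast Fintype.card_pos
  have hint : ∀ J J', Integrable (fun A : Fin n → Fin p → ℝ =>
      Real.exp (Λ * inner ℝ (signal (Matrix.of A) (u J)) (signal (Matrix.of A) (u J'))))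
      (gaussianDesign n p) := fun J J' => integrable_exp_inner_signal h0 h8 (hu J) (hu J')
  have hintS := integrable_finsetSum Finset.univ fun J (_ : J ∈ Finset.univ) =>
    integrable_finsetSum Finset.univ fun J' (_ : J' ∈ Finset.univ) => hint J J'
  refine measureReal_ge_le_of_integral_le
    (fun A => sub_nonneg.2 (card_sq_le_sum_exp_inner h0 _))
    (hintS.sub (integrable_const _)) (by positivity) ?_
  rw [integral_sub hintS (integrable_const _), integral_finsetSum _ fun J _ =>
    integrable_finsetSum Finset.univ fun J' (_ : J' ∈ Finset.univ) => hint J J']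
  simp_rw [fun J => integral_finsetSum Finset.univ fun J' (_ : J' ∈ Finset.univ) => hint J J']
  have h1 := Finset.sum_le_sum fun J (_ : J ∈ Finset.univ) =>
    Finset.sum_le_sum fun J' (_ : J' ∈ Finset.univ) =>
      integral_exp_inner_signal_le (n := n) h0 h8 (hu J) (hu J')
  simp only [integral_const, probReal_univ, one_smul]
  linarith

/-- For most designs, most vectors of the family have an image of the expected norm. -/
theorem gaussianDesign_card_small_ge [Nonempty ι] (hn : 0 < n) (hη : 80 * sqNormalVar / n ≤ η)
    (hu : ∀ J, ‖u J‖ = 1) :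
    (gaussianDesign n p).real {A | 1 / 10 * (Fintype.card ι : ℝ) ≤ ∑ J,
      {A : Fin n → Fin p → ℝ | ‖signal (Matrix.of A) (u J)‖ ^ 2 ≤ n / 2}.indicator 1 A}
      ≤ η / 2 := by
  have hM : (0 : ℝ) < Fintype.card ι := by exact_mod_cast Fintype.card_pos
  have hmeas : ∀ J, MeasurableSet {A : Fin n → Fin p → ℝ |
      ‖signal (Matrix.of A) (u J)‖ ^ 2 ≤ n / 2} := fun J =>
    measurableSet_le ((measurable_signal_of (u J)).norm.pow_const 2) measurable_const
  have hint : ∀ J, Integrable ({A : Fin n → Fin p → ℝ |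
      ‖signal (Matrix.of A) (u J)‖ ^ 2 ≤ n / 2}.indicator (1 : (Fin n → Fin p → ℝ) → ℝ)) (gaussianDesign n p) :=
    fun J => (integrable_const (1 : ℝ)).indicator (hmeas J)
  refine measureReal_ge_le_of_integral_le
    (fun A => Finset.sum_nonneg fun J _ => Set.indicator_nonneg (fun _ _ => zero_le_one) A)
    (integrable_finsetSum _ fun J _ => hint J) (by positivity) ?_
  change ∫ A, ∑ J, Set.indicator _ (1 : (Fin n → Fin p → ℝ) → ℝ) A ∂_ ≤ _
  rw [integral_finsetSum _ fun J _ => hint J]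
  simp_rw [fun J => integral_indicator_one (μ := gaussianDesign n p) (hmeas J)]
  refine (Finset.sum_le_card_nsmul _ _ _ fun J _ => gaussianDesign_norm_signal_le hn (hu J)).trans ?_
  rw [Finset.card_univ, nsmul_eq_mul]
  have := mul_le_mul_of_nonneg_left hη hM.le
  have h2 : (Fintype.card ι : ℝ) * (80 * sqNormalVar / n)
    = 20 * (Fintype.card ι * (4 * sqNormalVar / n)) := by ring
  linarith

/-- Dropping the vectors with a small image only decreases the sum of positive exponentials, and at
least nine tenths of the family remains. After scaling by `√Λ` the remaining images have squared
norm at least `nΛ/2`. -/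
theorem le_minimaxSeparation_sq_of_good_design [Nonempty ι] {σ : ℝ} (hα : 0 ≤ α) (hδ : 0 ≤ δ)
    (hαδ : α + δ ≤ 33 / 100) (hσ : 0 < σ) (h0 : 0 ≤ Λ)
    (husp : ∀ J, (u J : Fin p → ℝ) ∈ sparseVectors k p) (A : Fin n → Fin p → ℝ)
    (h1 : ∑ J, ∑ J', Real.exp (Λ * inner ℝ (signal (Matrix.of A) (u J)) (signal (Matrix.of A) (u J')))
        - (Fintype.card ι : ℝ) ^ 2 < 1 / 2 * (Fintype.card ι : ℝ) ^ 2)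
    (h2 : ∑ J, {A : Fin n → Fin p → ℝ | ‖signal (Matrix.of A) (u J)‖ ^ 2 ≤ n / 2}.indicator 1 A
        < 1 / 10 * (Fintype.card ι : ℝ)) :
    ENNReal.ofReal (Λ / 2) ≤ minimaxSeparation α δ k (Matrix.of A) σ ^ 2 := by
  classical
  have hM : (0 : ℝ) < Fintype.card ι := by exact_mod_cast Fintype.card_pos
  set G : Finset ι := Finset.univ.filter fun J => ¬ ‖signal (Matrix.of A) (u J)‖ ^ 2 ≤ n / 2 with hG
  have hcard : 9 / 10 * (Fintype.card ι : ℝ) ≤ G.card := by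
    have h3 := Finset.card_filter_add_card_filter_not (s := (Finset.univ : Finset ι))
      (fun J => ‖signal (Matrix.of A) (u J)‖ ^ 2 ≤ n / 2)
    have h4 : ∑ J, {A : Fin n → Fin p → ℝ | ‖signal (Matrix.of A) (u J)‖ ^ 2 ≤ n / 2}.indicator
        (1 : (Fin n → Fin p → ℝ) → ℝ) A
        = (Finset.univ.filter fun J => ‖signal (Matrix.of A) (u J)‖ ^ 2 ≤ n / 2).card := by
      simp [Set.indicator_apply]
    have h5 : ((Finset.univ.filter fun J => ‖signal (Matrix.of A) (u J)‖ ^ 2 ≤ n / 2).card : ℝ)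
        + G.card = Fintype.card ι := by
      exact_mod_cast h3
    rw [h4] at h2
    linarith
  have hGpos : (0 : ℝ) < G.card := by linarith
  have hsig : ∀ J, signal (Matrix.of A) (√Λ • (u J : Fin p → ℝ)) = √Λ • signal (Matrix.of A) (u J) :=
    fun J => by simp [signal, Matrix.mulVec_smul]
  refine le_minimaxSeparation_sq hα hδ hαδ hσ (by positivity) _ G
    (Finset.card_pos.1 (by exact_mod_cast hGpos)) (fun J => √Λ • (u J : Fin p → ℝ)) ?_ ?_ ?_
  · intro J _
    have := husp J
    simp only [sparseVectors, Set.mem_ofPred_eq] at this ⊢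
    refine (Finset.card_le_card fun i hi => ?_).trans this
    simp only [Finset.mem_filter, Finset.mem_univ, true_and, Pi.smul_apply, smul_eq_mul] at hi ⊢
    exact right_ne_zero_of_mul hi
  · intro J hJ
    have hJ' := (Finset.mem_filter.1 hJ).2
    rw [hsig, norm_smul, mul_pow, Real.norm_of_nonneg (Real.sqrt_nonneg _), Real.sq_sqrt h0]
    have := mul_le_mul_of_nonneg_left (not_le.1 hJ').le h0
    linarith
  · simp_rw [hsig, inner_smul_left, inner_smul_right, conj_trivial, ← mul_assoc,
      Real.mul_self_sqrt h0]
    have h3 : ∑ J ∈ G, ∑ J' ∈ G,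
        Real.exp (Λ * inner ℝ (signal (Matrix.of A) (u J)) (signal (Matrix.of A) (u J')))
        ≤ ∑ J, ∑ J',
        Real.exp (Λ * inner ℝ (signal (Matrix.of A) (u J)) (signal (Matrix.of A) (u J'))) := by
      refine (Finset.sum_le_sum fun J _ => Finset.sum_le_univ_sum_of_nonneg
        fun J' => (Real.exp_pos _).le).trans ?_
      exact Finset.sum_le_univ_sum_of_nonneg fun J => Finset.sum_nonneg fun J' _ => (Real.exp_pos _).le
    have h4 := pow_le_pow_left₀ (by positivity) hcard 2
    -- Numerically, `3/2 ≤ 2 * (9/10)²`.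
    nlinarith

/-- The two exceptional events do not involve `σ`, so one good design serves all `σ`. Covering the
bad set by them bounds its outer measure, with no measurability claim about the minimax distance. -/
theorem gaussianDesign_minimaxSeparation_lt [Nonempty ι] (hn : 0 < n) (hα : 0 ≤ α) (hδ : 0 ≤ δ)
    (hαδ : α + δ ≤ 33 / 100) (h0 : 0 ≤ Λ) (h8 : Λ ≤ 1 / 8)
    (husp : ∀ J, (u J : Fin p → ℝ) ∈ sparseVectors k p) (hu : ∀ J, ‖u J‖ = 1)
    (hsum : ∑ J, ∑ J', Real.exp (n * (Λ * inner ℝ (u J) (u J') + 200 * Λ ^ 2))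
      ≤ (1 + η / 4) * (Fintype.card ι : ℝ) ^ 2)
    (hη : 80 * sqNormalVar / n ≤ η) :
    gaussianDesign n p {A | ¬ ∀ σ : ℝ, 0 < σ →
      ENNReal.ofReal (Λ / 2) ≤ minimaxSeparation α δ k (Matrix.of A) σ ^ 2}
      ≤ ENNReal.ofReal η := by
  have h1 := gaussianDesign_sum_exp_ge h0 h8 hu hsum
  have h2 := gaussianDesign_card_small_ge (p := p) hn hη hu
  rw [← ofReal_measureReal]
  refine ENNReal.ofReal_le_ofReal ?_
  refine (measureReal_mono fun A hA => ?_).trans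
    ((measureReal_union_le _ _).trans ((add_le_add h1 h2).trans_eq (add_halves η)))
  by_contra hc
  rw [Set.mem_union, not_or] at hc
  exact hA fun σ hσ => le_minimaxSeparation_sq_of_good_design hα hδ hαδ hσ h0 husp A
    (not_le.1 hc.1) (not_le.1 hc.2)

end Family

/-! ### The block family and its overlaps -/

section Blocks

variable {k q p : ℕ}

/-- The index in `Fin p` of the `j`-th element of the `a`-th block of length `q`. -/
def blockIndex (h : k * q ≤ p) : Fin k × Fin q ↪ Fin p :=
  finProdFinEquiv.toEmbedding.trans (Fin.castLEEmb h)

/-- The unit vector with one equal non-zero entry in each of the `k` blocks. -/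
noncomputable def blockVector (h : k * q ≤ p) (J : Fin k → Fin q) : EuclideanSpace ℝ (Fin p) :=
  (√k)⁻¹ • ∑ a, EuclideanSpace.single (blockIndex h (a, J a)) (1 : ℝ)

theorem inner_blockVector (h : k * q ≤ p) (J J' : Fin k → Fin q) :
    inner ℝ (blockVector h J) (blockVector h J')
      = (k : ℝ)⁻¹ * ∑ a, if J a = J' a then (1 : ℝ) else 0 := by
  simp only [blockVector, inner_smul_left, inner_smul_right, conj_trivial, sum_inner, inner_sum,
    EuclideanSpace.inner_single_left, PiLp.single_apply, (blockIndex h).injective.eq_iff,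
    Prod.mk.injEq]
  rw [← Finset.mul_sum, ← mul_assoc, ← mul_inv, Real.mul_self_sqrt (Nat.cast_nonneg k)]
  congr 1
  refine Finset.sum_congr rfl fun a _ => ?_
  rw [Finset.sum_eq_single a]
  · simp
  · intro b _ hb
    simp [hb]
  · simp

theorem norm_blockVector (h : k * q ≤ p) (hk : 0 < k) (J : Fin k → Fin q) :
    ‖blockVector h J‖ = 1 := by
  have hk' : (k : ℝ) ≠ 0 := by positivity
  have h1 := inner_blockVector h J J
  rw [real_inner_self_eq_norm_sq] at h1
  simp only [if_true, Finset.sum_const, Finset.card_univ, Fintype.card_fin, nsmul_eq_mul, mul_one,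
    inv_mul_cancel₀ hk'] at h1
  exact (pow_eq_one_iff_of_nonneg (norm_nonneg _) two_ne_zero).1 h1

theorem blockVector_mem_sparseVectors (h : k * q ≤ p) (J : Fin k → Fin q) :
    (blockVector h J : Fin p → ℝ) ∈ sparseVectors k p := by
  classical
  have hsub : (Finset.univ.filter fun i => blockVector h J i ≠ 0) ⊆
      Finset.univ.image fun a => blockIndex h (a, J a) := by
    intro i hi
    by_contra hc
    refine (Finset.mem_filter.1 hi).2 ?_
    simp only [Finset.mem_image, Finset.mem_univ, true_and, not_exists] at hc
    simp only [blockVector, PiLp.smul_apply, WithLp.ofLp_sum, Finset.sum_apply, smul_eq_mul]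
    rw [Finset.sum_eq_zero fun a _ => ?_, mul_zero]
    simp [Ne.symm (hc a)]
  exact (Finset.card_le_card hsub).trans (Finset.card_image_le.trans (by simp))

/-- For fixed `J` the sum over `J'` factors over blocks. Each factor has one matching index and is
at most `q + e^l ≤ q exp (e^l / q)`. -/
theorem sum_exp_overlap_le (hq : 0 < q) (l : ℝ) :
    ∑ J : Fin k → Fin q, ∑ J' : Fin k → Fin q,
        Real.exp (l * ∑ a, if J a = J' a then (1 : ℝ) else 0)
      ≤ ((q : ℝ) ^ k) ^ 2 * Real.exp (k * (Real.exp l / q)) := by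
  have hq' : (0 : ℝ) < q := by exact_mod_cast hq
  have hinner : ∀ J : Fin k → Fin q, ∑ J' : Fin k → Fin q,
      Real.exp (l * ∑ a, if J a = J' a then (1 : ℝ) else 0) ≤ (q + Real.exp l) ^ k := fun J => by
    simp_rw [Finset.mul_sum, Real.exp_sum]
    rw [← Fintype.piFinset_univ, ← Finset.prod_univ_sum (fun _ => Finset.univ)
      fun a j => Real.exp (l * if J a = j then (1 : ℝ) else 0)]
    refine (Finset.prod_le_prod (g := fun _ => q + Real.exp l)
      (fun a _ => Finset.sum_nonneg fun j _ => (Real.exp_pos _).le) fun a _ => ?_).trans (by simp)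
    have : ∀ j, Real.exp (l * if J a = j then (1 : ℝ) else 0)
        ≤ 1 + if J a = j then Real.exp l else 0 := fun j => by
      split_ifs <;> simp
    refine (Finset.sum_le_sum fun j _ => this j).trans ?_
    simp [Finset.sum_add_distrib]
  refine (Finset.sum_le_sum fun J _ => hinner J).trans ?_
  have h1 : (q + Real.exp l) ^ k ≤ (q : ℝ) ^ k * Real.exp (k * (Real.exp l / q)) := by
    rw [Real.exp_nat_mul, ← mul_pow]
    refine pow_le_pow_left₀ (by positivity) ?_ k
    have := mul_le_mul_of_nonneg_left (Real.add_one_le_exp (Real.exp l / q)) hq'.le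
    rw [mul_add, mul_div_cancel₀ _ hq'.ne'] at this
    linarith
  rw [Finset.sum_const, Finset.card_univ, nsmul_eq_mul]
  simp only [Fintype.card_pi, Fintype.card_fin, Finset.prod_const, Finset.card_univ, Nat.cast_pow]
  rw [sq, mul_assoc]
  gcongr

end Blocks

/-! ### Calibration and the main theorem -/

theorem two_le_log_of_nine_le {p : ℕ} (hp : 9 ≤ p) : 2 ≤ Real.log p := by
  have hp' : (9 : ℝ) ≤ p := by exact_mod_cast hp
  rw [Real.le_log_iff_exp_le (by linarith), show (2 : ℝ) = 1 + 1 by norm_num, Real.exp_add]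
  have := Real.exp_one_lt_three
  nlinarith [Real.exp_pos 1]

/-- The rate is already saturated at `k = ⌊√n⌋`, because `√n ≤ ⌊√n⌋ + 1 ≤ ⌊√n⌋ log p`. The block
construction is therefore needed only for `k² ≤ n`. -/
theorem testingRate_le_testingRate_min {n p : ℕ} (hn : 0 < n) (hlog : 2 ≤ Real.log p) (k : ℕ) :
    testingRate k n p ≤ testingRate (min k n.sqrt) n p := by
  rcases le_total k n.sqrt with h | h
  · rw [min_eq_left h]
  rw [min_eq_right h]
  have hn' : (0 : ℝ) < n := by exact_mod_cast hn
  refine le_of_mul_le_mul_left ?_ hn'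
  rw [mul_testingRate hn, mul_testingRate hn]
  refine le_min ((min_le_right _ _).trans ?_) (min_le_right _ _)
  have h1 : (1 : ℝ) ≤ n.sqrt := by exact_mod_cast Nat.sqrt_pos.2 hn
  have h2 : √(n : ℝ) ≤ n.sqrt + 1 := Real.real_sqrt_le_nat_sqrt_succ
  nlinarith

theorem mul_testingRate_sq_le_one {n : ℕ} (hn : 0 < n) {k p : ℕ} (hR : 0 ≤ testingRate k n p) :
    n * testingRate k n p ^ 2 ≤ 1 := by
  have hn' : (0 : ℝ) < n := by exact_mod_cast hn
  have h1 : n * testingRate k n p ≤ √n := mul_testingRate hn k p ▸ min_le_right _ _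
  have h2 := pow_le_pow_left₀ (by positivity) h1 2
  rw [Real.sq_sqrt hn'.le] at h2
  exact le_of_mul_le_mul_left (by linarith) hn'

theorem block_overlap_exponent_le {n p k : ℕ} {c : ℝ} (hc : 0 < c) (hc8 : 2 * c ≤ 1 / 4)
    (hn : 3 ≤ n) (hp : n ^ 2 ≤ p) (hk : 1 ≤ k) (hkn : k ^ 2 ≤ n) :
    k * (Real.exp (n * (2 * (c * testingRate k n p)) * (k : ℝ)⁻¹) / (p / k : ℕ)) ≤ 2 / √n := by
  have hn0 : 0 < n := by omega
  have hn' : (3 : ℝ) ≤ n := by exact_mod_cast hn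
  have hk' : (1 : ℝ) ≤ k := by exact_mod_cast hk
  have hkn' : (k : ℝ) ^ 2 ≤ n := by exact_mod_cast hkn
  have hp' : (n : ℝ) ^ 2 ≤ p := by exact_mod_cast hp
  have hp9 : 9 ≤ p := by nlinarith
  have hp0 : (0 : ℝ) < p := by positivity
  have hlog := two_le_log_of_nine_le hp9
  have hkk : k ≤ n := by nlinarith
  have h2kp : 2 * k ≤ p := by nlinarith
  have hq : 0 < p / k := Nat.div_pos (by omega) hk
  have hq' : (0 : ℝ) < (p / k : ℕ) := by exact_mod_cast hq
  set R := testingRate k n p with hR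
  set l := n * (2 * (c * R)) * (k : ℝ)⁻¹ with hl
  have hnR : n * R = min (k * Real.log p) √n := mul_testingRate hn0 k p
  have hR0 : 0 < R := testingRate_pos hn0 hk (by linarith)
  have hnR0 : 0 ≤ n * R := by positivity
  -- All quantities are compared with `r = p^(1/4)`: `√n ≤ r` and `e^l ≤ r`, while `k² ≤ n ≤ r²`.
  set r := Real.exp (Real.log p / 4) with hr
  have hr4 : r ^ 4 = p := by
    rw [hr, ← Real.exp_nat_mul, Nat.cast_ofNat, mul_div_cancel₀ _ (by norm_num), Real.exp_log hp0]
  have hr0 : 0 < r := Real.exp_pos _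
  have hnr : (n : ℝ) ≤ r ^ 2 := by
    refine le_of_sq_le_sq ?_ (by positivity)
    calc (n : ℝ) ^ 2 ≤ p := hp'
      _ = (r ^ 2) ^ 2 := by rw [← hr4]; ring
  have hsr : √(n : ℝ) ≤ r := (Real.sqrt_le_left hr0.le).2 hnr
  have hl_le : l ≤ Real.log p / 4 := by
    have h1 : n * R ≤ k * Real.log p := hnR ▸ min_le_left _ _
    have h2 : l = 2 * c * (n * R) / k := by rw [hl]; field_simp
    rw [h2, div_le_iff₀ (by linarith)]
    have h3 : 2 * c * (n * R) ≤ 1 / 4 * (n * R) := mul_le_mul_of_nonneg_right hc8 hnR0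
    linarith
  have hexp_l : Real.exp l ≤ r := Real.exp_le_exp.2 hl_le
  -- Rounding the block length down loses at most a factor two, since `p / k ≥ 1`.
  have hqlow : (p : ℝ) ≤ 2 * k * (p / k : ℕ) := by
    have h1 : p < k * (p / k) + k := (Nat.lt_mul_div_succ p hk).trans_eq (by ring)
    have h2 : k ≤ k * (p / k) := Nat.le_mul_of_pos_right k hq
    have h3 : p ≤ 2 * k * (p / k) := by linarith
    exact_mod_cast h3
  rw [← mul_div_assoc, div_le_div_iff₀ hq' (by positivity)]
  have h1 : k * Real.exp l * √n ≤ k * r * r := by gcongr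
  have h2 : k * (k * r * r) ≤ k * (2 * (p / k : ℕ)) := by
    calc k * (k * r * r) = k ^ 2 * r ^ 2 := by ring
      _ ≤ r ^ 2 * r ^ 2 := mul_le_mul_of_nonneg_right (hkn'.trans hnr) (by positivity)
      _ = p := by rw [← hr4]; ring
      _ ≤ _ := by linarith
  exact h1.trans (le_of_mul_le_mul_left h2 (by linarith))

/-- The bound on the second moment of the likelihood ratio for the block mixture. -/
theorem sum_exp_blockVector_le {n p k : ℕ} {η : ℝ} (hη : 0 < η) (hη1 : η < 1)
    (hn : 3 ≤ n) (hnη : 20 / η ≤ √n) (hp : n ^ 2 ≤ p) (hk : 1 ≤ k)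
    (hkn : k ^ 2 ≤ n) (h : k * (p / k) ≤ p) :
    ∑ J : Fin k → Fin (p / k), ∑ J' : Fin k → Fin (p / k),
      Real.exp (n * ((2 * (η / 200 * testingRate k n p)) *
        inner ℝ (blockVector h J) (blockVector h J')
        + 200 * (2 * (η / 200 * testingRate k n p)) ^ 2))
      ≤ (1 + η / 4) * (Fintype.card (Fin k → Fin (p / k)) : ℝ) ^ 2 := by
  have hn0 : 0 < n := by omega
  have hn' : (0 : ℝ) < n := by exact_mod_cast hn0
  have hq : 0 < p / k := Nat.div_pos (by nlinarith) hk
  have hR0 : 0 < testingRate k n p :=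
    testingRate_pos hn0 hk (by linarith [two_le_log_of_nine_le (show 9 ≤ p by nlinarith)])
  have hov := block_overlap_exponent_le (c := η / 200) (by positivity) (by linarith) hn hp hk hkn
  have hsq := mul_le_mul_of_nonneg_left (mul_testingRate_sq_le_one hn0 hR0.le)
    (show 0 ≤ η ^ 2 / 50 by positivity)
  generalize testingRate k n p = R at *
  set l := n * (2 * (η / 200 * R)) * (k : ℝ)⁻¹ with hl
  have hterm : ∀ J J' : Fin k → Fin (p / k),
      Real.exp (n * ((2 * (η / 200 * R)) * inner ℝ (blockVector h J) (blockVector h J')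
        + 200 * (2 * (η / 200 * R)) ^ 2))
      ≤ Real.exp (η ^ 2 / 50) * Real.exp (l * ∑ a, if J a = J' a then (1 : ℝ) else 0) :=
    fun J J' => by
      rw [← Real.exp_add, inner_blockVector, Real.exp_le_exp, hl]
      linarith
  refine (Finset.sum_le_sum fun J _ => Finset.sum_le_sum fun J' _ => hterm J J').trans ?_
  simp_rw [← Finset.mul_sum]
  refine (mul_le_mul_of_nonneg_left (sum_exp_overlap_le hq l) (Real.exp_pos _).le).trans ?_
  have hcard : (Fintype.card (Fin k → Fin (p / k)) : ℝ) = ((p / k : ℕ) : ℝ) ^ k := by simp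
  rw [hcard, mul_left_comm, ← Real.exp_add, mul_comm]
  refine mul_le_mul_of_nonneg_right ?_ (sq_nonneg _)
  have hx0 : 0 ≤ η ^ 2 / 50 + k * (Real.exp l / (p / k : ℕ)) := by positivity
  -- The sum is at most `η/50 + η/10`; then `exp x ≤ 1 + x + x² ≤ 1 + 2x` yields `1 + η/4`.
  have hx : η ^ 2 / 50 + k * (Real.exp l / (p / k : ℕ)) ≤ η / 8 := by
    have h1 : 2 / √n ≤ η / 10 := by
      rw [div_le_iff₀ hη] at hnη
      rw [div_le_iff₀ (by positivity)]
      linarith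
    have h2 : η ^ 2 ≤ η := by nlinarith
    linarith
  generalize η ^ 2 / 50 + k * (Real.exp l / (p / k : ℕ)) = x at hx hx0 ⊢
  have h1 := Real.abs_exp_sub_one_sub_id_le (x := x) (by rw [abs_of_nonneg hx0]; linarith)
  nlinarith [(abs_le.1 h1).2]

theorem gaussianDesign_lower_bound {η : ℝ} (hη : 0 < η) (hη1 : η < 1) {α δ : ℝ} (hα : 0 ≤ α)
    (hδ : 0 ≤ δ) (hαδ : α + δ ≤ 33 / 100) {n p k : ℕ}
    (hn : 400 / η ^ 2 + 80 * sqNormalVar / η + 3 ≤ n) (hp : n ^ 2 ≤ p) (hk : 1 ≤ k) :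
    gaussianDesign n p {A | ¬ ∀ σ : ℝ, 0 < σ →
      ENNReal.ofReal (η / 200 * testingRate k n p) ≤
        minimaxSeparation α δ k (Matrix.of A) σ ^ 2} ≤ ENNReal.ofReal η := by
  have hκ := sqNormalVar_nonneg
  have ha : 0 < 400 / η ^ 2 := by positivity
  have hb : 0 ≤ 80 * sqNormalVar / η := by positivity
  have hn3 : 3 ≤ n := by
    have : (3 : ℝ) ≤ n := by linarith
    exact_mod_cast this
  have hn0 : 0 < n := by omega
  have hn' : (0 : ℝ) < n := by exact_mod_cast hn0
  have hlog := two_le_log_of_nine_le (show 9 ≤ p by nlinarith)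
  set m := min k n.sqrt with hm
  have hm1 : 1 ≤ m := le_min hk (Nat.sqrt_pos.2 hn0)
  have hmn : m ^ 2 ≤ n := (Nat.pow_le_pow_left (min_le_right _ _) 2).trans (Nat.sqrt_le' n)
  have hblock : m * (p / m) ≤ p := Nat.mul_div_le p m
  have hmp : m ≤ p := by nlinarith
  have hne : Nonempty (Fin m → Fin (p / m)) :=
    ⟨fun _ => ⟨0, Nat.div_pos hmp hm1⟩⟩
  have hR := testingRate_pos hn0 hm1 (show 0 < Real.log p by linarith)
  have hR1 : testingRate m n p ≤ 1 := by
    refine (min_le_right _ _).trans ((div_le_one (by positivity)).2 (Real.one_le_sqrt.2 ?_))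
    exact_mod_cast hn0
  have hnη : 20 / η ≤ √n := by
    refine Real.le_sqrt_of_sq_le ?_
    rw [div_pow]
    norm_num
    linarith
  have hκn : 80 * sqNormalVar / n ≤ η := by
    rw [div_le_iff₀ hn']
    have h1 : 80 * sqNormalVar / η ≤ n := by linarith
    rw [div_le_iff₀ hη] at h1
    linarith
  -- The factor `2` in `Λ` offsets the `Λ / 2` in the conclusion. The vectors are `m`-sparse, hence
  -- also `k`-sparse.
  have key := gaussianDesign_minimaxSeparation_lt (k := k) (α := α) (δ := δ)
    (Λ := 2 * (η / 200 * testingRate m n p)) (u := blockVector hblock) hn0 hα hδ hαδ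
    (by positivity) (by nlinarith)
    (fun J => le_trans (α := ℕ) (blockVector_mem_sparseVectors hblock J) (min_le_left _ _))
    (norm_blockVector hblock hm1)
    (sum_exp_blockVector_le hη hη1 hn3 hnη hp hm1 hmn hblock) hκn
  refine (measure_mono fun A hA => ?_).trans key
  refine fun hc => hA fun σ hσ => le_trans (ENNReal.ofReal_le_ofReal ?_) (hc σ hσ)
  rw [mul_div_cancel_left₀ _ two_ne_zero]
  exact mul_le_mul_of_nonneg_left (testingRate_le_testingRate_min hn0 hlog k) (by positivity)

theorem mainTheorem5 :
    (∃ c : ℝ, 0 < c ∧ ∀ α δ : ℝ, 0 < α → 0 < δ → α + δ ≤ 33 / 100 →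
      ∃ N D : ℝ, 0 < D ∧ ∀ n p : ℕ, N ≤ (n : ℝ) ^ 2 → n ^ 2 ≤ p →
        8 * Real.log (2 / δ) ≤ (n : ℝ) →
        (∀ k : ℕ, 1 ≤ k → k ≤ n → ∃ X : Matrix (Fin n) (Fin p) ℝ, ∀ σ : ℝ, 0 < σ →
          ENNReal.ofReal (c * testingRate k n p) ≤ minimaxSeparation α δ k X σ ^ 2) ∧
        (∀ k : ℕ, 1 ≤ k → k ≤ p → ∀ (X : Matrix (Fin n) (Fin p) ℝ) (σ : ℝ), 0 < σ →
          minimaxSeparation α δ k X σ ^ 2 ≤ ENNReal.ofReal (D * testingRate k n p)) ∧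
        (∀ (X : Matrix (Fin n) (Fin p) ℝ) (σ : ℝ), 0 < σ →
          IsLevelTest α X σ (tStar α X σ) ∧
          ∀ k : ℕ, 1 ≤ k → k ≤ p →
            separationDistance δ (tStar α X σ) k X σ ^ 2 ≤
              ENNReal.ofReal (D * testingRate k n p))) ∧
    (∀ η : ℝ, 0 < η → η < 1 → ∃ c : ℝ, 0 < c ∧
      ∀ α δ : ℝ, 0 < α → 0 < δ → α + δ ≤ 33 / 100 →
      ∃ N : ℝ, ∀ n p : ℕ, N ≤ (n : ℝ) ^ 2 → n ^ 2 ≤ p →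
        8 * Real.log (2 / δ) ≤ (n : ℝ) →
        ∀ k : ℕ, 1 ≤ k → k ≤ n →
          gaussianDesign n p {A | ¬ ∀ σ : ℝ, 0 < σ →
            ENNReal.ofReal (c * testingRate k n p) ≤
              minimaxSeparation α δ k (Matrix.of A) σ ^ 2} ≤ ENNReal.ofReal η) := by
  have hκ := sqNormalVar_nonneg
  constructor
  · refine ⟨1 / 2 / 200, by norm_num, fun α δ hα hδ hαδ => ?_⟩
    have hL1 : 0 ≤ Real.log (1 / δ) := Real.log_nonneg (by rw [le_div_iff₀ hδ]; linarith)
    have hL2 : 0 ≤ Real.log (2 / α) := Real.log_nonneg (by rw [le_div_iff₀ hα]; linarith)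
    refine ⟨(400 / (1 / 2) ^ 2 + 80 * sqNormalVar / (1 / 2) + 3) ^ 2, upperConstant α δ,
      by unfold upperConstant; positivity, fun n p hN hp _ => ?_⟩
    have hn : 400 / (1 / 2) ^ 2 + 80 * sqNormalVar / (1 / 2) + 3 ≤ (n : ℝ) :=
      le_of_sq_le_sq hN (Nat.cast_nonneg n)
    have hn3 : 3 ≤ n := by
      have : (3 : ℝ) ≤ n := le_trans (le_add_of_nonneg_left (by positivity)) hn
      exact_mod_cast this
    have hn1 : (1 : ℝ) ≤ n := by exact_mod_cast (show 1 ≤ n by omega)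
    have hp9 : 9 ≤ p := by nlinarith
    have hlog := two_le_log_of_nine_le hp9
    have hsqrt : √(n : ℝ) ≤ p := by
      refine (Real.sqrt_le_left (Nat.cast_nonneg p)).2 ?_
      have h1 : n ≤ p ^ 2 := by nlinarith
      exact_mod_cast h1
    have hlevel : ∀ (X : Matrix (Fin n) (Fin p) ℝ) (σ : ℝ), 0 < σ →
        IsLevelTest α X σ (tStar α X σ) := fun X σ hσ =>
      isLevelTest_tStar hα hσ X hsqrt (by omega)
    have hupper : ∀ (X : Matrix (Fin n) (Fin p) ℝ) (σ : ℝ), 0 < σ → ∀ k : ℕ, 1 ≤ k → k ≤ p →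
        separationDistance δ (tStar α X σ) k X σ ^ 2 ≤
          ENNReal.ofReal (upperConstant α δ * testingRate k n p) := fun X σ hσ k hk hkp =>
      separationDistance_tStar_sq_le hα (by linarith) hδ (by linarith) hσ X (by omega)
        (by linarith) hsqrt hk hkp
    refine ⟨fun k hk _ => ?_, fun k hk hkp X σ hσ => ?_, fun X σ hσ =>
      ⟨hlevel X σ hσ, hupper X σ hσ⟩⟩
    -- Probabilistic method: if every design failed for some `σ`, the bad set would have probability
    -- one, not at most `1/2`.
    · by_contra hc
      push Not at hc
      have hall : {A : Fin n → Fin p → ℝ | ¬ ∀ σ : ℝ, 0 < σ →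
          ENNReal.ofReal (1 / 2 / 200 * testingRate k n p) ≤
            minimaxSeparation α δ k (Matrix.of A) σ ^ 2} = Set.univ := by
        refine Set.eq_univ_of_forall fun A h => ?_
        obtain ⟨σ, hσ, hlt⟩ := hc (Matrix.of A)
        exact absurd (h σ hσ) (not_le.2 hlt)
      have h := gaussianDesign_lower_bound one_half_pos one_half_lt_one hα.le hδ.le hαδ hn hp hk
      rw [hall, measure_univ, ← ENNReal.ofReal_one, ENNReal.ofReal_le_ofReal_iff (by norm_num)] at h
      norm_num at h
    · refine le_trans ?_ (hupper X σ hσ k hk hkp)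
      gcongr
      exact iInf₂_le _ (hlevel X σ hσ)
  · refine fun η hη hη1 => ⟨η / 200, by positivity, fun α δ hα hδ hαδ =>
      ⟨(400 / η ^ 2 + 80 * sqNormalVar / η + 3) ^ 2, fun n p hN hp _ k hk _ => ?_⟩⟩
    exact gaussianDesign_lower_bound hη hη1 hα.le hδ.le hαδ
      (le_of_sq_le_sq hN (Nat.cast_nonneg n)) hp hk
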